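/- Let $\Bbbk$ be an algebraically closed field of characteristic zero and let $H$ be a finite-dimensional Hopf algebra over $\Bbbk$ with $\dim H>1$. Let $H_0$ be the coradical of $H$, i.e. the sum of all simple subcoalgebras of $H$. Suppose that $H_0=\Bbbk\cdot 1\oplus E$, where $E$ is a direct sum of simple subcoalgebras of $H$, each of dimension divisible by $N^2$, for some integer $N>1$. Let $\dim H\equiv d \pmod N$ with $0\le d\le N-1$, let $1\le e\le N$ with $e\equiv d-1\pmod N$, and assume that $e\neq 1$. Then $$\dim H\;\ge\;\dim H_0+4N+2N^2+e .$$ -/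

import Mathlib

open scoped TensorProduct

/-- A subspace `C` of a coalgebra `D` is a subcoalgebra if `Δ(C) ⊆ C ⊗ C`, where `C ⊗ C` is
regarded as a subspace of `D ⊗ D`. -/
def IsSubcoalgebra {k D : Type*} [Field k] [AddCommGroup D] [Module k D] [Coalgebra k D]
    (C : Submodule k D) : Prop :=
  ∀ x ∈ C, Coalgebra.comul (R := k) x ∈
    LinearMap.range (TensorProduct.map C.subtype C.subtype : C ⊗[k] C →ₗ[k] D ⊗[k] D)

/-- A simple subcoalgebra: a nonzero subcoalgebra whose only subcoalgebras are `0` and itself. -/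
def IsSimpleSubcoalgebra {k D : Type*} [Field k] [AddCommGroup D] [Module k D] [Coalgebra k D]
    (C : Submodule k D) : Prop :=
  IsSubcoalgebra C ∧ C ≠ ⊥ ∧ ∀ B : Submodule k D, IsSubcoalgebra B → B ≤ C → B = ⊥ ∨ B = C

/-- The coradical `D₀` of a coalgebra `D`: the sum of all its simple subcoalgebras. -/
def coradical (k D : Type*) [Field k] [AddCommGroup D] [Module k D] [Coalgebra k D] :
    Submodule k D :=
  sSup {C : Submodule k D | IsSimpleSubcoalgebra C}

/-! Pass to the dual algebra A = H*, realised as the convolution algebra of functionals on H. The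
shape of H₀ says that A modulo its radical J is k × ∏ M_{dᵢ}(k) with N ∣ dᵢ, the factor k being the
augmentation ε, evaluation at 1 (`exists_isBlockPresentation`). Lift the unit of that factor to an
idempotent p, and lift N × N matrix units to a system in A with sum 1 - p. Decompose J into the
Peirce corners U = pJp, X = pJ(1-p), Y = (1-p)Jp, Z = (1-p)J(1-p). The matrix units force N ∣ dim X,
N ∣ dim Y and N² ∣ dim Z, so dim U ≡ dim J ≡ dim H - 1 ≡ e mod N.

Three facts about Hopf algebras enter. Integrals in A are unique up to scalar, and as N > 1 makes ε
the only character of A, left and right integrals coincide (`isLeftIntegral_iff_isRightIntegral`).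
In characteristic zero H has no nonzero primitive element, so U ⊆ U² + XY, and nilpotency improves
this to U ⊆ XY (`augmentation_corner_le`, `corner_le`). Finally U ≠ 0: otherwise p would be an
integral, and a trace count on V ⊗ V* would give N ∣ 1 (`corner_ne_bot`).

Hence dim U ≥ e ≥ 2. If YXY, XYX or ZZ vanished, A would have too many integrals or a left integral
that is not a right one (`triple_products_ne_bot`). So 0 < XYX < X, 0 < YXY < Y and 0 < ZZ < Z,
strictly by nilpotency, and divisibility yields dimensions at least 2N, 2N and 2N². Thus dim J ≥ e +
4N + 2N², while H₀ lies in the annihilator of J. -/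

open Coalgebra HopfAlgebra WithConv

/-! ### The convolution algebra and multiplicative matrices -/

section DualAlgebra
variable {k H : Type*} [Field k] [AddCommGroup H] [Module k H]

/-- Products of coordinate functionals already separate tensors. This turns coalgebra identities
into identities between convolution products. -/
theorem tensorProduct_ext_dual [FiniteDimensional k H] {t t' : H ⊗[k] H}
    (h : ∀ a c : H →ₗ[k] k, LinearMap.mul' k k (TensorProduct.map a c t) =
      LinearMap.mul' k k (TensorProduct.map a c t')) : t = t' := by
  let b := Module.finBasis k H
  apply (b.tensorProduct b).ext_elem
  rintro ⟨i, j⟩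
  have key : ∀ t : H ⊗[k] H, (b.tensorProduct b).repr t (i, j) =
      LinearMap.mul' k k (TensorProduct.map (b.coord i) (b.coord j) t) := by
    intro t
    induction t with
    | zero => simp
    | tmul x y => simp [mul_comm]
    | add x y hx hy => simp [hx, hy]
  rw [key, key, h]

theorem eq_of_forall_conv {x y : H} (h : ∀ a : WithConv (H →ₗ[k] k), a x = a y) : x = y := by
  rw [← sub_eq_zero, ← Module.forall_dual_apply_eq_zero_iff k]
  intro f
  have := h (toConv f)
  simpa [sub_eq_zero] using this

variable [Coalgebra k H]

/-- A square matrix over a coalgebra is multiplicative if `Δ uᵢⱼ = ∑ₗ uᵢₗ ⊗ uₗⱼ` and `ε uᵢⱼ = δᵢⱼ`. -/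
structure IsMultiplicativeMatrix (k : Type*) {H ι : Type*} [Field k] [AddCommGroup H] [Module k H]
    [Coalgebra k H] [Fintype ι] [DecidableEq ι] (u : Matrix ι ι H) : Prop where
  comul_apply : ∀ i j, comul (R := k) (u i j) = ∑ l, u i l ⊗ₜ[k] u l j
  counit_apply : ∀ i j, counit (R := k) (u i j) = if i = j then 1 else 0

variable {ι : Type*} [Fintype ι] [DecidableEq ι]

theorem IsMultiplicativeMatrix.of_conv [FiniteDimensional k H] {u : Matrix ι ι H}
    (hmul : ∀ (a c : WithConv (H →ₗ[k] k)) i j, (a * c) (u i j) = ∑ l, a (u i l) * c (u l j))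
    (hone : ∀ i j, (1 : WithConv (H →ₗ[k] k)) (u i j) = if i = j then 1 else 0) :
    IsMultiplicativeMatrix k u where
  comul_apply i j := tensorProduct_ext_dual fun a c => by
    have := hmul (toConv a) (toConv c) i j
    rw [LinearMap.convMul_apply] at this
    simpa using this
  counit_apply i j := by simpa using hone i j

theorem IsMultiplicativeMatrix.conv_mul {u : Matrix ι ι H} (hu : IsMultiplicativeMatrix k u)
    (a c : WithConv (H →ₗ[k] k)) (i j : ι) : (a * c) (u i j) = ∑ l, a (u i l) * c (u l j) := by
  simp [LinearMap.convMul_apply, hu.comul_apply]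

/-- The representation of the convolution algebra given by a multiplicative matrix. -/
noncomputable def IsMultiplicativeMatrix.rep {u : Matrix ι ι H} (hu : IsMultiplicativeMatrix k u) :
    WithConv (H →ₗ[k] k) →ₐ[k] Matrix ι ι k :=
  AlgHom.ofLinearMap
    { toFun := fun a => Matrix.of fun i j => a (u i j)
      map_add' := fun a c => by ext; simp
      map_smul' := fun r a => by ext; simp }
    (by ext i j; simp [hu.counit_apply, Matrix.one_apply])
    (fun a c => by ext i j; simp only [LinearMap.coe_mk, AddHom.coe_mk, Matrix.of_apply,
      Matrix.mul_apply]; exact hu.conv_mul a c i j)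

@[simp] theorem IsMultiplicativeMatrix.rep_apply {u : Matrix ι ι H}
    (hu : IsMultiplicativeMatrix k u) (a : WithConv (H →ₗ[k] k)) (i j : ι) :
    hu.rep a i j = a (u i j) := rfl

/-- The coefficients of the regular representation of the convolution algebra in a basis. -/
noncomputable def basisMatrix (b : Module.Basis ι k H) : Matrix ι ι H :=
  Matrix.of fun i j => TensorProduct.rid k H (LinearMap.lTensor H (b.coord j) (comul (b i)))

omit [Fintype ι] [DecidableEq ι] in
theorem conv_basisMatrix (b : Module.Basis ι k H) (a : WithConv (H →ₗ[k] k)) (i j : ι) :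
    a (basisMatrix b i j) = (a * toConv (b.coord j)) (b i) := by
  rw [LinearMap.convMul_apply]
  simp only [basisMatrix, Matrix.of_apply]
  generalize comul (R := k) (b i) = t
  induction t with
  | zero => simp
  | tmul x y => simp [mul_comm]
  | add x y hx hy => simp only [map_add, hx, hy]

omit [DecidableEq ι] in
theorem conv_eq_sum_coord (b : Module.Basis ι k H) (a : WithConv (H →ₗ[k] k)) :
    a = ∑ i, a (b i) • toConv (b.coord i) := by
  ext x
  conv_lhs => rw [← b.sum_repr x]
  simp

theorem isMultiplicativeMatrix_basisMatrix [FiniteDimensional k H] (b : Module.Basis ι k H) :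
    IsMultiplicativeMatrix k (basisMatrix b) := by
  apply IsMultiplicativeMatrix.of_conv
  · intro a c i j
    rw [conv_basisMatrix, mul_assoc]
    conv_lhs => rw [conv_eq_sum_coord b (c * _)]
    simp [conv_basisMatrix, Finset.mul_sum, mul_comm]
  · intro i j
    rw [conv_basisMatrix, one_mul]
    simp [Finsupp.single_apply]

omit [DecidableEq ι] in
theorem comul_basis [FiniteDimensional k H] (b : Module.Basis ι k H) (i : ι) :
    comul (R := k) (b i) = ∑ j, basisMatrix b i j ⊗ₜ[k] b j := by
  apply tensorProduct_ext_dual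
  intro a c
  have h := LinearMap.convMul_apply (toConv a) (toConv c) (b i)
  rw [← toConv_ofConv (toConv c)] at h
  have h2 : (toConv a * toConv c : WithConv (H →ₗ[k] k)) (b i) =
      ∑ j, a (basisMatrix b i j) * c (b j) := by
    rw [conv_eq_sum_coord b (toConv c)]
    have := fun j => conv_basisMatrix b (toConv a) i j
    simp only at this
    simp [Finset.mul_sum, this, mul_comm]
  rw [LinearMap.convMul_apply] at h2
  simpa using h2

omit [DecidableEq ι] in
theorem sum_counit_smul_basisMatrix (b : Module.Basis ι k H) (i : ι) :
    ∑ j, counit (R := k) (b j) • basisMatrix b i j = b i := by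
  apply eq_of_forall_conv (k := k)
  intro a
  rw [map_sum]
  simp only [map_smul, conv_basisMatrix]
  conv_rhs => rw [← mul_one a, conv_eq_sum_coord b 1]
  simp [Finset.mul_sum]

end DualAlgebra

/-! ### The antipode in matrix form -/

section Hopf
variable {k H : Type*} [Field k] [Ring H] [HopfAlgebra k H]
variable {ι : Type*} [Fintype ι] [DecidableEq ι]

theorem IsMultiplicativeMatrix.antipode_mul {u : Matrix ι ι H} (hu : IsMultiplicativeMatrix k u) :
    u.map (antipode k) * u = 1 := by
  ext i j
  have := mul_antipode_rTensor_comul_apply (R := k) (u i j)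
  rw [hu.comul_apply] at this
  simp only [map_sum, LinearMap.rTensor_tmul, LinearMap.mul'_apply, hu.counit_apply] at this
  rw [Matrix.mul_apply]
  simp only [Matrix.map_apply, this, Matrix.one_apply]
  split <;> simp

theorem IsMultiplicativeMatrix.mul_antipode {u : Matrix ι ι H} (hu : IsMultiplicativeMatrix k u) :
    u * u.map (antipode k) = 1 := by
  ext i j
  have := mul_antipode_lTensor_comul_apply (R := k) (u i j)
  rw [hu.comul_apply] at this
  simp only [map_sum, LinearMap.lTensor_tmul, LinearMap.mul'_apply, hu.counit_apply] at this
  rw [Matrix.mul_apply]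
  simp only [Matrix.map_apply, this, Matrix.one_apply]
  split <;> simp

theorem IsMultiplicativeMatrix.sum_antipode_mul {u : Matrix ι ι H}
    (hu : IsMultiplicativeMatrix k u) (i j : ι) :
    ∑ l, antipode k (u i l) * u l j = if i = j then 1 else 0 := by
  have := congrFun (congrFun hu.antipode_mul i) j
  simpa [Matrix.mul_apply, Matrix.one_apply] using this

theorem IsMultiplicativeMatrix.sum_mul_antipode {u : Matrix ι ι H}
    (hu : IsMultiplicativeMatrix k u) (i j : ι) :
    ∑ l, u i l * antipode k (u l j) = if i = j then 1 else 0 := by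
  have := congrFun (congrFun hu.mul_antipode i) j
  simpa [Matrix.mul_apply, Matrix.one_apply] using this

/-- The matrix Δ(u) has right inverse Δ(S(u)), since Δ is an algebra map, and the claimed formula is
a left inverse; the two therefore agree. -/
theorem IsMultiplicativeMatrix.comul_antipode {u : Matrix ι ι H}
    (hu : IsMultiplicativeMatrix k u) (i j : ι) :
    comul (R := k) (antipode k (u i j)) = ∑ l, antipode k (u l j) ⊗ₜ[k] antipode k (u i l) := by
  let G : Matrix ι ι (H ⊗[k] H) :=
    Matrix.of fun i j => ∑ l, antipode k (u l j) ⊗ₜ[k] antipode k (u i l)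
  let D : Matrix ι ι (H ⊗[k] H) := u.map (comul (R := k))
  let F : Matrix ι ι (H ⊗[k] H) := (u.map (antipode k)).map (comul (R := k))
  have hDF : D * F = 1 := by
    have : D * F = (u * u.map (antipode k)).map (Bialgebra.comulAlgHom k H) := by
      rw [Matrix.map_mul]; rfl
    rw [this, hu.mul_antipode, Matrix.map_one _ (map_zero _) (map_one _)]
  have hGD : G * D = 1 := by
    ext i j
    simp only [G, D, Matrix.mul_apply, Matrix.of_apply, Matrix.map_apply, hu.comul_apply,
      Finset.sum_mul_sum, Algebra.TensorProduct.tmul_mul_tmul]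
    calc ∑ m, ∑ l, ∑ p, (antipode k (u l m) * u m p) ⊗ₜ[k] (antipode k (u i l) * u p j)
        = ∑ l, ∑ p, (∑ m, antipode k (u l m) * u m p) ⊗ₜ[k] (antipode k (u i l) * u p j) := by
          simp only [TensorProduct.sum_tmul]
          rw [Finset.sum_comm]
          exact Finset.sum_congr rfl fun l _ => Finset.sum_comm
      _ = ∑ l, (1 : H) ⊗ₜ[k] (antipode k (u i l) * u l j) := by
          refine Finset.sum_congr rfl fun l _ => ?_
          simp only [hu.sum_antipode_mul]
          rw [Finset.sum_eq_single l]
          · simp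
          · intro b _ hb; simp [hb.symm]
          · simp
      _ = (1 : Matrix ι ι (H ⊗[k] H)) i j := by
          rw [← TensorProduct.tmul_sum, hu.sum_antipode_mul, Matrix.one_apply]
          split <;> simp [Algebra.TensorProduct.one_def]
  have hGF : G = F := left_inv_eq_right_inv hGD hDF
  have := congrFun (congrFun hGF i) j
  simpa [G, F] using this.symm

omit [DecidableEq ι] in
-- The entries of `basisMatrix b` span H and comultiply like matrix coefficients, so Sweedler
-- computations reduce to matrix computations.
theorem linearMap_ext_basisMatrix {M : Type*} [AddCommGroup M] [Module k M]
    (b : Module.Basis ι k H) {f g : H →ₗ[k] M}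
    (h : ∀ i j, f (basisMatrix b i j) = g (basisMatrix b i j)) : f = g := by
  apply b.ext
  intro i
  rw [← sum_counit_smul_basisMatrix b i]
  simp [h]

variable [FiniteDimensional k H]

theorem comul_antipode_apply (h : H) : comul (R := k) (antipode k h) =
    TensorProduct.map (antipode k) (antipode k) (TensorProduct.comm k H H (comul h)) := by
  have : comul (R := k) ∘ₗ antipode k = TensorProduct.map (antipode k) (antipode k) ∘ₗ
      (TensorProduct.comm k H H).toLinearMap ∘ₗ comul (R := k) (A := H) := by
    apply linearMap_ext_basisMatrix (Module.finBasis k H)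
    intro i j
    have hv := isMultiplicativeMatrix_basisMatrix (Module.finBasis k H)
    simp [hv.comul_antipode, hv.comul_apply]
  exact congr($this h)

theorem comul_antipode_antipode_apply (h : H) : comul (R := k) (antipode k (antipode k h)) =
    TensorProduct.map (antipode k ∘ₗ antipode k) (antipode k ∘ₗ antipode k) (comul (R := k) h) := by
  rw [comul_antipode_apply, comul_antipode_apply]
  generalize comul (R := k) h = t
  induction t with
  | zero => simp
  | tmul x y => simp
  | add x y hx hy => simp only [map_add, hx, hy]

theorem conv_comp_antipode (a c : WithConv (H →ₗ[k] k)) :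
    toConv ((a * c).ofConv ∘ₗ antipode k) =
      toConv (c.ofConv ∘ₗ antipode k) * toConv (a.ofConv ∘ₗ antipode k) := by
  ext x
  change (a * c) (antipode k x) = _
  rw [LinearMap.convMul_apply, LinearMap.convMul_apply, comul_antipode_apply]
  generalize comul (R := k) x = t
  induction t with
  | zero => simp
  | tmul x y => simp [mul_comm]
  | add x y hx hy => simp only [map_add, hx, hy]

omit [FiniteDimensional k H] in
theorem conv_mul_apply_mul {y : H} {κ : Type*} [Fintype κ] {p q : κ → H}
    (hy : comul (R := k) y = ∑ l, p l ⊗ₜ[k] q l) (a c : WithConv (H →ₗ[k] k)) (x : H) :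
    (a * c) (x * y) =
      ∑ s ∈ (ℛ k x).index, ∑ l, a ((ℛ k x).left s * p l) * c ((ℛ k x).right s * q l) := by
  rw [LinearMap.convMul_apply, Bialgebra.comul_mul, hy]
  conv_lhs => rw [← (ℛ k x).eq]
  simp [Finset.sum_mul_sum]

/-! ### Integrals: uniqueness and existence -/

/-- Left integrals of the convolution algebra. -/
def IsLeftIntegral (l : WithConv (H →ₗ[k] k)) : Prop :=
  ∀ a : WithConv (H →ₗ[k] k), a * l = a 1 • l

/-- Right integrals of the convolution algebra. -/
def IsRightIntegral (l : WithConv (H →ₗ[k] k)) : Prop :=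
  ∀ a : WithConv (H →ₗ[k] k), l * a = a 1 • l

/-- The functional `x ↦ l (x S(h))`. -/
noncomputable def dualTranslate (l : WithConv (H →ₗ[k] k)) : H →ₗ[k] WithConv (H →ₗ[k] k) :=
  (WithConv.linearEquiv k (H →ₗ[k] k)).symm.toLinearMap ∘ₗ
    (LinearMap.llcomp k H H k l.ofConv) ∘ₗ (LinearMap.mul k H).flip ∘ₗ antipode k

omit [FiniteDimensional k H] in
@[simp] theorem dualTranslate_apply (l : WithConv (H →ₗ[k] k)) (h x : H) :
    dualTranslate l h x = l (x * antipode k h) := rfl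

/-- The left action `a ⇀ h = h₁ a(h₂)` of the convolution algebra. -/
noncomputable def dualAct (a : WithConv (H →ₗ[k] k)) : H →ₗ[k] H :=
  (TensorProduct.rid k H).toLinearMap ∘ₗ LinearMap.lTensor H a.ofConv ∘ₗ comul

omit [FiniteDimensional k H] in
theorem conv_dualAct (a c : WithConv (H →ₗ[k] k)) (h : H) : c (dualAct a h) = (c * a) h := by
  rw [LinearMap.convMul_apply]
  simp only [dualAct, LinearMap.comp_apply]
  generalize comul (R := k) h = t
  induction t with
  | zero => simp
  | tmul x y => simp [mul_comm]
  | add x y hx hy => simp only [map_add, hx, hy]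

omit [FiniteDimensional k H] in
theorem IsMultiplicativeMatrix.dualAct_apply {u : Matrix ι ι H} (hu : IsMultiplicativeMatrix k u)
    (a : WithConv (H →ₗ[k] k)) (i j : ι) : dualAct a (u i j) = ∑ l, a (u l j) • u i l := by
  simp [dualAct, hu.comul_apply]

omit [FiniteDimensional k H] in
theorem IsLeftIntegral.dualAct_self {l : WithConv (H →ₗ[k] k)} (hl : IsLeftIntegral l) (x : H) :
    dualAct l x = l x • 1 := by
  apply eq_of_forall_conv (k := k)
  intro a
  rw [conv_dualAct, hl a]
  simp [mul_comm]

/-- In Sweedler notation x₁ l(x₂ S(h)) = x₁ S(h₂) h₃ l(x₂ S(h₁)) = l(x S(h₁)) h₂, the last step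
because l is an integral; then apply a. -/
theorem IsLeftIntegral.mul_dualTranslate {l : WithConv (H →ₗ[k] k)} (hl : IsLeftIntegral l)
    (a : WithConv (H →ₗ[k] k)) (h : H) :
    a * dualTranslate l h = dualTranslate l (dualAct a h) := by
  let b := Module.finBasis k H
  have hv := isMultiplicativeMatrix_basisMatrix b
  set v := basisMatrix b
  have : LinearMap.mulLeft k a ∘ₗ dualTranslate l = dualTranslate l ∘ₗ dualAct a := by
    apply linearMap_ext_basisMatrix b
    intro i j
    change a * dualTranslate l (v i j) = dualTranslate l (dualAct a (v i j))
    rw [hv.dualAct_apply]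
    ext x
    set R := ℛ k x
    have key : ∀ p, ∑ s ∈ R.index, ∑ m, l (R.right s * antipode k (v i m)) •
        (R.left s * antipode k (v m p)) = l (x * antipode k (v i p)) • 1 := by
      intro p
      rw [← hl.dualAct_self]
      simp only [dualAct, LinearMap.comp_apply, Bialgebra.comul_mul, hv.comul_antipode]
      rw [← R.eq]
      simp [Finset.sum_mul_sum]
    have key2 : ∑ s ∈ R.index, l (R.right s * antipode k (v i j)) • R.left s =
        ∑ p, l (x * antipode k (v i p)) • v p j := by
      calc _ = ∑ s ∈ R.index, ∑ m, l (R.right s * antipode k (v i m)) •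
            (R.left s * ∑ p, antipode k (v m p) * v p j) := by
            refine Finset.sum_congr rfl fun s _ => ?_
            simp only [hv.sum_antipode_mul]
            rw [Finset.sum_eq_single j]
            · simp
            · intro m _ hm; simp [hm]
            · simp
        _ = ∑ p, (∑ s ∈ R.index, ∑ m, l (R.right s * antipode k (v i m)) •
              (R.left s * antipode k (v m p))) * v p j := by
            simp only [Finset.sum_mul, Finset.mul_sum, Finset.smul_sum, smul_mul_assoc, mul_assoc]
            rw [Finset.sum_comm]
            rw [Finset.sum_comm]
            conv_rhs => rw [Finset.sum_comm]
            refine Finset.sum_congr rfl fun s _ => ?_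
            exact Finset.sum_comm
        _ = _ := by simp [key]
    have key3 := congrArg a.ofConv key2
    rw [R.convMul_apply]
    simp only [map_sum, map_smul, smul_eq_mul] at key3
    simp only [dualTranslate_apply, map_sum, map_smul, ofConv_sum, ofConv_smul,
      LinearMap.sum_apply, LinearMap.smul_apply, smul_eq_mul]
    calc _ = ∑ s ∈ R.index, l (R.right s * antipode k (v i j)) * a (R.left s) :=
          Finset.sum_congr rfl fun s _ => mul_comm _ _
      _ = _ := key3
      _ = _ := Finset.sum_congr rfl fun s _ => mul_comm _ _
  exact congr($this h)

theorem sum_dualAct_mul_antipode (b : Module.Basis ι k H) (h : H) :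
    ∑ j, dualAct (toConv (b.coord j)) h * antipode k (b j) = counit (R := k) h • 1 := by
  have hc : comul (R := k) h = ∑ j, dualAct (toConv (b.coord j)) h ⊗ₜ[k] b j := by
    have : comul (R := k) (A := H) =
        ∑ j, (TensorProduct.mk k H H).flip (b j) ∘ₗ dualAct (toConv (b.coord j)) := by
      apply b.ext
      intro i
      rw [comul_basis]
      simp only [LinearMap.sum_apply, LinearMap.comp_apply, LinearMap.flip_apply,
        TensorProduct.mk_apply]
      rfl
    simpa using congr($this h)
  have := mul_antipode_lTensor_comul_apply (R := k) h
  rw [hc] at this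
  simpa [Algebra.algebraMap_eq_smul_one] using this

/-- The kernel is stable under `dualAct` and under right multiplication by S(y). With h it contains
h₁ S(h₂) = ε(h)1, and 1 maps to l ≠ 0, so ε(h) = 0. Applied to all a ⇀ h this gives a(h) = 0 for
every a. -/
theorem IsLeftIntegral.dualTranslate_injective {l : WithConv (H →ₗ[k] k)} (hl : IsLeftIntegral l)
    (h0 : l ≠ 0) : Function.Injective (dualTranslate l) := by
  have step : ∀ h, dualTranslate l h = 0 → counit (R := k) h = 0 := by
    intro h hh
    let b := Module.finBasis k H
    by_contra hne
    apply h0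
    have h1 : ∀ y, dualTranslate l (dualAct (toConv (b.coord y)) h * antipode k (b y)) = 0 := by
      intro y
      have h2 : dualTranslate l (dualAct (toConv (b.coord y)) h) = 0 := by
        rw [← hl.mul_dualTranslate, hh, mul_zero]
      ext x
      have := congr($h2 (x * antipode k (antipode k (b y))))
      simpa [antipode_mul_antidistrib, mul_assoc] using this
    have h3 := congrArg (dualTranslate l) (sum_dualAct_mul_antipode b h)
    rw [map_sum, Finset.sum_eq_zero fun y _ => h1 y, map_smul] at h3
    have h4 := (smul_eq_zero.mp h3.symm).resolve_left hne
    ext x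
    simpa using congr($h4 x)
  rw [← LinearMap.ker_eq_bot, LinearMap.ker_eq_bot']
  intro h hh
  apply eq_of_forall_conv (k := k)
  intro a
  have := step (dualAct a h) (by rw [← hl.mul_dualTranslate, hh, mul_zero])
  have h2 := conv_dualAct a 1 h
  rw [one_mul] at h2
  rw [← h2]
  simpa using this

omit [FiniteDimensional k H] in
theorem finrank_withConv_dual :
    Module.finrank k (WithConv (H →ₗ[k] k)) = Module.finrank k H := by
  rw [(WithConv.linearEquiv k (H →ₗ[k] k)).finrank_eq]
  exact Subspace.dual_finrank_eq

instance : FiniteDimensional k (WithConv (H →ₗ[k] k)) :=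
  Module.Finite.equiv (WithConv.linearEquiv k (H →ₗ[k] k)).symm

/-- By equality of dimensions `dualTranslate l` is an isomorphism of A-modules from H to A. Left
integrals correspond to the h with a ⇀ h = a(1)h, which are the multiples of 1. -/
theorem IsLeftIntegral.eq_smul {l l' : WithConv (H →ₗ[k] k)} (hl : IsLeftIntegral l)
    (h0 : l ≠ 0) (hl' : IsLeftIntegral l') : ∃ c : k, l' = c • l := by
  have hinj := hl.dualTranslate_injective h0
  have hsurj := (LinearMap.injective_iff_surjective_of_finrank_eq_finrank
    (finrank_withConv_dual (k := k) (H := H)).symm).mp hinj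
  obtain ⟨h, rfl⟩ := hsurj l'
  have h1 : ∀ a : WithConv (H →ₗ[k] k), dualAct a h = a 1 • h := by
    intro a
    apply hinj
    rw [← hl.mul_dualTranslate, hl' a, map_smul]
  have h2 : h = counit (R := k) h • 1 := by
    apply eq_of_forall_conv (k := k)
    intro a
    have h3 := conv_dualAct a 1 h
    rw [one_mul, h1 a] at h3
    rw [← h3]
    simp [mul_comm]
  refine ⟨counit (R := k) h, ?_⟩
  rw [h2]
  ext x
  simp

theorem IsLeftIntegral.antipode_injective {l : WithConv (H →ₗ[k] k)} (hl : IsLeftIntegral l)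
    (h0 : l ≠ 0) : Function.Injective (antipode k : H →ₗ[k] H) := by
  intro x y hxy
  apply hl.dualTranslate_injective h0
  ext z
  simp [hxy]

/-- Composition with S is a bijective anti-homomorphism of A preserving evaluation at 1. -/
theorem IsRightIntegral.comp_antipode {r l : WithConv (H →ₗ[k] k)} (hr : IsRightIntegral r)
    (hl : IsLeftIntegral l) (h0 : l ≠ 0) : IsLeftIntegral (toConv (r.ofConv ∘ₗ antipode k)) := by
  have hsurj := LinearMap.injective_iff_surjective.mp (hl.antipode_injective h0)
  have hS : ∀ a : WithConv (H →ₗ[k] k), ∃ c : WithConv (H →ₗ[k] k),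
      a = toConv (c.ofConv ∘ₗ antipode k) := by
    intro a
    let e := LinearEquiv.ofBijective (antipode k : H →ₗ[k] H) ⟨hl.antipode_injective h0, hsurj⟩
    refine ⟨toConv (a.ofConv ∘ₗ e.symm.toLinearMap), ?_⟩
    ext x
    have : e.symm (antipode k x) = x := e.symm_apply_apply x
    simp [this]
  intro a
  obtain ⟨c, rfl⟩ := hS a
  rw [← conv_comp_antipode, hr c]
  ext x
  simp

theorem IsRightIntegral.eq_smul {l r r' : WithConv (H →ₗ[k] k)} (hl : IsLeftIntegral l)
    (h0 : l ≠ 0) (hr : IsRightIntegral r) (hr0 : r ≠ 0) (hr' : IsRightIntegral r') :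
    ∃ c : k, r' = c • r := by
  have hsurj := LinearMap.injective_iff_surjective.mp (hl.antipode_injective h0)
  have hne : toConv (r.ofConv ∘ₗ antipode k) ≠ 0 := by
    intro h
    apply hr0
    ext x
    obtain ⟨y, rfl⟩ := hsurj x
    simpa using congr($h y)
  obtain ⟨c, hc⟩ := (hr.comp_antipode hl h0).eq_smul hne (hr'.comp_antipode hl h0)
  refine ⟨c, ?_⟩
  ext x
  obtain ⟨y, rfl⟩ := hsurj x
  simpa using congr($hc y)

/-- The functional `x ↦ Tr(y ↦ (x S²(y))₁ g((x S²(y))₂))`. -/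
noncomputable def traceIntegral (b : Module.Basis ι k H) (g : WithConv (H →ₗ[k] k)) :
    WithConv (H →ₗ[k] k) :=
  ∑ i, dualTranslate (toConv (b.coord i) * g) (antipode k (b i))

/-- Evaluating c * bᵢ* * g at x S²(bⱼ), once through the comultiplication and once in the dual
basis, gives `key`. On taking the trace the surplus factors cancel by `hTS` and by v S(v) = 1. -/
theorem isLeftIntegral_traceIntegral (b : Module.Basis ι k H) (g : WithConv (H →ₗ[k] k)) :
    IsLeftIntegral (traceIntegral b g) := by
  have hv := isMultiplicativeMatrix_basisMatrix b
  set v := basisMatrix b with hvdef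
  let T : H → H := fun y => antipode k (antipode k y)
  let G : ι → ι → H → k := fun i j x => (toConv (b.coord i) * g) (x * T (b j))
  have htr : ∀ x, traceIntegral b g x = ∑ i, G i i x := by
    intro x
    simp [traceIntegral, G, T]
  have hT : ∀ j, comul (R := k) (T (b j)) = ∑ p, T (v j p) ⊗ₜ[k] T (b p) := by
    intro j
    simp only [T]
    rw [comul_antipode_antipode_apply, comul_basis]
    simp [hvdef]
  have hTS : ∀ p i, ∑ j, T (v j p) * antipode k (v i j) = if i = p then 1 else 0 := by
    intro p i
    have := congrArg (antipode k) (hv.sum_mul_antipode i p)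
    simp only [map_sum, antipode_mul_antidistrib] at this
    rw [this]
    split <;> simp
  intro a
  ext x
  set R := ℛ k x
  have key : ∀ i j, ∑ s ∈ R.index, ∑ p, G i p (R.right s) • (R.left s * T (v j p)) =
      ∑ p, G p j x • v p i := by
    intro i j
    apply eq_of_forall_conv (k := k)
    intro c
    have h1 := conv_mul_apply_mul (hT j) c (toConv (b.coord i) * g) x
    have h2 : (c * (toConv (b.coord i) * g)) (x * T (b j)) = ∑ p, G p j x * c (v p i) := by
      rw [← mul_assoc, conv_eq_sum_coord b (c * toConv (b.coord i)), Finset.sum_mul]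
      simp [G, hvdef, conv_basisMatrix, mul_comm]
    rw [h1] at h2
    simp only [map_sum, map_smul, smul_eq_mul]
    rw [← h2]
    exact Finset.sum_congr rfl fun s _ => Finset.sum_congr rfl fun p _ => mul_comm _ _
  have key2 : ∑ s ∈ R.index, traceIntegral b g (R.right s) • R.left s =
      traceIntegral b g x • 1 := by
    calc _ = ∑ i, ∑ s ∈ R.index, ∑ p, G i p (R.right s) •
          (R.left s * ∑ j, T (v j p) * antipode k (v i j)) := by
          rw [Finset.sum_comm]
          refine Finset.sum_congr rfl fun s _ => ?_
          rw [htr, Finset.sum_smul]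
          refine Finset.sum_congr rfl fun i _ => ?_
          simp [hTS]
      _ = ∑ i, ∑ j, (∑ s ∈ R.index, ∑ p, G i p (R.right s) • (R.left s * T (v j p))) *
            antipode k (v i j) := by
          refine Finset.sum_congr rfl fun i _ => ?_
          simp only [Finset.sum_mul, Finset.mul_sum, Finset.smul_sum, smul_mul_assoc, mul_assoc]
          conv_rhs => rw [Finset.sum_comm]
          refine Finset.sum_congr rfl fun s _ => ?_
          exact Finset.sum_comm
      _ = ∑ j, ∑ p, G p j x • ∑ i, v p i * antipode k (v i j) := by
          simp only [key, Finset.sum_mul, Finset.smul_sum, smul_mul_assoc]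
          rw [Finset.sum_comm]
          refine Finset.sum_congr rfl fun s _ => ?_
          exact Finset.sum_comm
      _ = _ := by
          simp only [hv.sum_mul_antipode, htr, Finset.sum_smul]
          refine Finset.sum_congr rfl fun j _ => ?_
          rw [Finset.sum_eq_single j]
          · simp
          · intro p _ hp; simp [hp]
          · simp
  have key3 := congrArg a.ofConv key2
  rw [R.convMul_apply]
  simp only [map_sum, map_smul, smul_eq_mul] at key3
  simp only [ofConv_smul, LinearMap.smul_apply, smul_eq_mul]
  calc _ = ∑ s ∈ R.index, traceIntegral b g (R.right s) * a (R.left s) :=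
        Finset.sum_congr rfl fun s _ => mul_comm _ _
    _ = _ := key3
    _ = _ := mul_comm _ _

/-- Shows that some trace integral is nonzero. Since S(bⱼ) S²(bᵢ) = S(S(bᵢ) bⱼ), the double sum
collapses through S(h₁) h₂ = ε(h)1 to ε(1) = 1. -/
theorem sum_traceIntegral_antipode (b : Module.Basis ι k H) :
    ∑ j, traceIntegral b (toConv (b.coord j)) (antipode k (b j)) = 1 := by
  have h1 : ∀ i j, (toConv (b.coord i) * toConv (b.coord j) : WithConv (H →ₗ[k] k)) =
      ∑ m, (toConv (b.coord i) * toConv (b.coord j) : WithConv (H →ₗ[k] k)) (b m) •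
        toConv (b.coord m) := fun i j => conv_eq_sum_coord b _
  have h2 : ∀ m, ∑ j, ∑ i, (toConv (b.coord i) * toConv (b.coord j) : WithConv (H →ₗ[k] k)) (b m) •
      (antipode k (b j) * antipode k (antipode k (b i))) = counit (R := k) (b m) • 1 := by
    intro m
    have hc : comul (R := k) (b m) = ∑ j, ∑ i,
        (toConv (b.coord i) * toConv (b.coord j) : WithConv (H →ₗ[k] k)) (b m) •
          (b i ⊗ₜ[k] b j) := by
      rw [comul_basis]
      refine Finset.sum_congr rfl fun j _ => ?_
      conv_lhs => rw [← b.sum_repr (basisMatrix b m j)]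
      rw [TensorProduct.sum_tmul]
      refine Finset.sum_congr rfl fun i _ => ?_
      rw [← conv_basisMatrix, TensorProduct.smul_tmul']
      rfl
    have := congrArg (antipode k) (mul_antipode_rTensor_comul_apply (R := k) (b m))
    rw [hc] at this
    simpa [antipode_mul_antidistrib, Algebra.algebraMap_eq_smul_one] using this
  calc _ = ∑ j, ∑ i, (toConv (b.coord i) * toConv (b.coord j) : WithConv (H →ₗ[k] k))
        (antipode k (b j) * antipode k (antipode k (b i))) := by
        simp [traceIntegral]
    _ = ∑ j, ∑ i, ∑ m, (toConv (b.coord i) * toConv (b.coord j) : WithConv (H →ₗ[k] k)) (b m) *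
        b.coord m (antipode k (b j) * antipode k (antipode k (b i))) := by
        refine Finset.sum_congr rfl fun j _ => Finset.sum_congr rfl fun i _ => ?_
        conv_lhs => rw [h1 i j]
        simp
    _ = ∑ m, b.coord m (∑ j, ∑ i,
          (toConv (b.coord i) * toConv (b.coord j) : WithConv (H →ₗ[k] k)) (b m) •
          (antipode k (b j) * antipode k (antipode k (b i)))) := by
        simp only [map_sum, map_smul, smul_eq_mul]
        rw [Finset.sum_comm' (t' := Finset.univ) (s' := fun _ => Finset.univ) (by simp)]
        conv_rhs => rw [Finset.sum_comm]
        rw [Finset.sum_comm]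
        refine Finset.sum_congr rfl fun j _ => ?_
        exact Finset.sum_comm
    _ = (1 : WithConv (H →ₗ[k] k)) 1 := by
        have h3 := congr($(conv_eq_sum_coord b (1 : WithConv (H →ₗ[k] k))) (1 : H))
        simp only [ofConv_sum, ofConv_smul, LinearMap.sum_apply, LinearMap.smul_apply] at h3
        rw [h3]
        simp only [h2]
        simp
    _ = 1 := by simp

variable (k H) in
theorem exists_isLeftIntegral_ne_zero : ∃ l : WithConv (H →ₗ[k] k), IsLeftIntegral l ∧ l ≠ 0 := by
  let b := Module.finBasis k H
  by_contra! h
  have := sum_traceIntegral_antipode b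
  simp [h _ (isLeftIntegral_traceIntegral b _)] at this

/-! ### Primitive elements in characteristic zero -/

omit [FiniteDimensional k H] in
theorem conv_mul_pow_of_primitive {x : H}
    (hx : comul (R := k) x = 1 ⊗ₜ[k] x + x ⊗ₜ[k] 1) (a c : WithConv (H →ₗ[k] k)) (n : ℕ) :
    (a * c) (x ^ n) = ∑ m ∈ Finset.range (n + 1), n.choose m * (a (x ^ m) * c (x ^ (n - m))) := by
  have hcomm : Commute (x ⊗ₜ[k] (1 : H)) ((1 : H) ⊗ₜ[k] x) := by
    simp [Commute, SemiconjBy]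
  rw [LinearMap.convMul_apply, Bialgebra.comul_pow, hx, add_comm, hcomm.add_pow, map_sum, map_sum]
  refine Finset.sum_congr rfl fun m _ => ?_
  rw [← (Nat.cast_commute _ _).eq]
  simp only [← nsmul_eq_mul]
  simp only [Algebra.TensorProduct.tmul_pow, one_pow, Algebra.TensorProduct.tmul_mul_tmul,
    mul_one, one_mul, map_nsmul, TensorProduct.map_tmul, LinearMap.mul'_apply]

/-- A functional a with a(1) = 0 and a(x) = 1 acts like differentiation in x: aᵐ kills xⁿ for n < m
and takes the value m! at xᵐ. So x ≠ 0 could satisfy no monic polynomial, against finite dimension.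
-/
theorem eq_zero_of_primitive [CharZero k] {x : H}
    (hx : comul (R := k) x = 1 ⊗ₜ[k] x + x ⊗ₜ[k] 1) : x = 0 := by
  by_contra hne
  -- Evaluating ε * ε = ε at x gives 2ε(x) = ε(x).
  have hex : counit (R := k) x = 0 := by
    have := conv_mul_pow_of_primitive hx 1 1 1
    simpa [Finset.sum_range_succ] using this
  obtain ⟨a, ha1, hax⟩ : ∃ a : WithConv (H →ₗ[k] k), a 1 = 0 ∧ a x = 1 := by
    obtain ⟨f, hf⟩ := Module.Projective.exists_dual_ne_zero k hne
    replace hf : (((f x)⁻¹ • f : Module.Dual k H)) x = 1 := by simp [hf]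
    generalize (f x)⁻¹ • f = f at hf
    refine ⟨toConv f - (f 1) • 1, ?_, ?_⟩ <;> simp [hf, hex]
  have key : ∀ m, (∀ n < m, (a ^ m) (x ^ n) = 0) ∧ (a ^ m) (x ^ m) = m.factorial := by
    intro m
    induction m with
    | zero => simp
    | succ m ih =>
      have hz : ∀ n ≤ m + 1, ∀ p ≤ n, p ≠ 1 →
          (n.choose p : k) * (a (x ^ p) * (a ^ m) (x ^ (n - p))) = 0 := by
        intro n hn p hp hp1
        rcases Nat.eq_zero_or_pos p with rfl | hp0
        · simp [ha1]
        · rw [ih.1 (n - p) (by omega)]; simp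
      constructor
      · intro n hn
        rw [pow_succ', conv_mul_pow_of_primitive hx]
        refine Finset.sum_eq_zero fun p hp => ?_
        by_cases hp1 : p = 1
        · subst hp1
          rw [ih.1 (n - 1) (by simp at hp; omega)]; simp
        · exact hz n hn.le p (by simp at hp; omega) hp1
      · rw [pow_succ', conv_mul_pow_of_primitive hx, Finset.sum_eq_single 1]
        · simp [hax, ih.2, Nat.factorial_succ]
        · intro p hp hp1
          exact hz _ le_rfl p (by simp at hp; omega) hp1
        · simp
  have hint : IsIntegral k x := Algebra.IsIntegral.isIntegral x
  -- Only the leading term of the minimal polynomial survives, with value (deg)!.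
  have h0 := congrArg (a ^ (minpoly k x).natDegree).ofConv (minpoly.aeval k x)
  rw [Polynomial.aeval_eq_sum_range, map_sum, Finset.sum_range_succ, Finset.sum_eq_zero] at h0
  · rw [map_smul, (key _).2, Polynomial.coeff_natDegree, (minpoly.monic hint).leadingCoeff] at h0
    simp [Nat.factorial_ne_zero] at h0
  · intro i hi
    rw [map_smul, (key _).1 i (by simpa using hi), smul_zero]

/-! ### The representation V ⊗ V* and its invariants -/

omit [FiniteDimensional k H] in
theorem IsMultiplicativeMatrix.adjoint {u : Matrix ι ι H} (hu : IsMultiplicativeMatrix k u) :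
    IsMultiplicativeMatrix k
      (Matrix.of fun p q : ι × ι => u p.1 q.1 * antipode k (u q.2 p.2)) where
  comul_apply p q := by
    simp only [Matrix.of_apply, Bialgebra.comul_mul, hu.comul_apply, hu.comul_antipode,
      Finset.sum_mul_sum, Algebra.TensorProduct.tmul_mul_tmul]
    rw [Fintype.sum_prod_type]
  counit_apply p q := by
    simp only [Matrix.of_apply, Bialgebra.counit_mul, counit_antipode, hu.counit_apply,
      Prod.ext_iff]
    by_cases h1 : p.1 = q.1 <;> by_cases h2 : p.2 = q.2 <;> simp [h1, h2, eq_comm]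

omit [FiniteDimensional k H] in
-- A normalised integral projects onto the invariants of V ⊗ V* = End V. By Schur these are the
-- scalars when V is irreducible, so the trace is 1.
theorem IsMultiplicativeMatrix.trace_adjoint_integral [Nonempty ι] {u : Matrix ι ι H}
    (hu : IsMultiplicativeMatrix k u) (hsurj : Function.Surjective hu.rep)
    {e : WithConv (H →ₗ[k] k)} (he : IsLeftIntegral e) (he1 : e 1 = 1) :
    (hu.adjoint.rep e).trace = 1 := by
  have hinv : ∀ q, ∃ s : k, ∀ p : ι × ι, hu.adjoint.rep e p q = if p.1 = p.2 then s else 0 := by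
    intro q
    -- Each column of the matrix of e, read as an endomorphism of V, is invariant and hence central.
    let Φ : Matrix ι ι k := Matrix.of fun i j => hu.adjoint.rep e (i, j) q
    have h1 : ∀ i j, ∑ x, ∑ y, Φ x y • (u i x * antipode k (u y j)) = Φ i j • (1 : H) := by
      intro i j
      apply eq_of_forall_conv (k := k)
      intro a
      have := congrFun (congrFun (congrArg hu.adjoint.rep (he a)) (i, j)) q
      rw [map_mul, Matrix.mul_apply, Fintype.sum_prod_type] at this
      simp only [map_smul, Matrix.smul_apply, hu.adjoint.rep_apply a, Matrix.of_apply] at this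
      simp only [map_sum, map_smul, smul_eq_mul, Φ, Matrix.of_apply]
      rw [mul_comm _ (a 1), ← smul_eq_mul, ← this]
      exact Finset.sum_congr rfl fun s _ => Finset.sum_congr rfl fun p _ => mul_comm _ _
    have h2 : ∀ i j, ∑ x, Φ x j • u i x = ∑ x, Φ i x • u x j := by
      intro i j
      calc _ = ∑ x, ∑ y, Φ x y • (u i x * ∑ z, antipode k (u y z) * u z j) := by
            refine Finset.sum_congr rfl fun x _ => ?_
            simp [hu.sum_antipode_mul]
        _ = ∑ z, (∑ x, ∑ y, Φ x y • (u i x * antipode k (u y z))) * u z j := by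
            simp only [Finset.sum_mul, Finset.mul_sum, Finset.smul_sum, smul_mul_assoc, mul_assoc]
            conv_rhs => rw [Finset.sum_comm]
            refine Finset.sum_congr rfl fun s _ => ?_
            exact Finset.sum_comm
        _ = _ := by simp [h1]
    have h3 : ∀ M : Matrix ι ι k, Commute M Φ := by
      intro M
      obtain ⟨a, rfl⟩ := hsurj M
      ext i j
      have := congrArg a.ofConv (h2 i j)
      simp only [map_sum, map_smul, smul_eq_mul] at this
      rw [Matrix.mul_apply, Matrix.mul_apply]
      simp only [hu.rep_apply]
      rw [← this]
      exact Finset.sum_congr rfl fun s _ => mul_comm _ _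
    obtain ⟨s, hs⟩ := Matrix.mem_range_scalar_of_commute_single (M := Φ) fun i j _ => h3 _
    refine ⟨s, fun p => ?_⟩
    have : Φ p.1 p.2 = hu.adjoint.rep e p q := rfl
    rw [← this, ← hs]
    simp [Matrix.diagonal_apply]
  choose s hs using hinv
  obtain ⟨i0⟩ := ‹Nonempty ι›
  have hone : ∑ q : ι, s (q, q) = 1 := by
    have : ∑ q : ι, hu.adjoint.rep e (i0, i0) (q, q) = 1 := by
      simp only [hu.adjoint.rep_apply, Matrix.of_apply]
      rw [← map_sum, hu.sum_mul_antipode]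
      simpa using he1
    rw [← this]
    exact Finset.sum_congr rfl fun q _ => by rw [hs]; simp
  rw [Matrix.trace, Fintype.sum_prod_type, ← hone]
  refine Finset.sum_congr rfl fun i _ => ?_
  simp only [Matrix.diag_apply, hs]
  simp
end Hopf

/-! ### Matrix units, Peirce corners and dimension bounds -/

section RingTheory
variable {k A : Type*} [Field k]

/-- As tr(st) = tr(ts), all these idempotents have the same trace, which is their rank;
characteristic zero makes the sum of traces an equality of natural numbers. -/
theorem card_dvd_finrank_of_idempotents [CharZero k] {V κ : Type*} [AddCommGroup V] [Module k V]
    [FiniteDimensional k V] [Fintype κ] (p : κ → Module.End k V)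
    (hp : ∀ x, IsIdempotentElem (p x)) (hsum : ∑ x, p x = 1)
    (hconj : ∀ x y, ∃ s t, p x = s * t ∧ p y = t * s) :
    Fintype.card κ ∣ Module.finrank k V := by
  rcases isEmpty_or_nonempty κ with hκ | ⟨⟨x0⟩⟩
  · have h1 := congrArg (LinearMap.trace k V) hsum
    simp only [Finset.univ_eq_empty, Finset.sum_empty, map_zero, LinearMap.trace_one] at h1
    have : Module.finrank k V = 0 := by exact_mod_cast h1.symm
    simp [this]
  · refine ⟨Module.finrank k (LinearMap.range (p x0)), ?_⟩
    have htr : ∀ x, LinearMap.trace k V (p x) =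
        (Module.finrank k (LinearMap.range (p x0)) : k) := by
      intro x
      rw [← (LinearMap.IsIdempotentElem.isProj_range _ (hp x0)).trace]
      obtain ⟨s, t, h1, h2⟩ := hconj x x0
      rw [h1, h2, LinearMap.trace_mul_comm]
    have h1 := congrArg (LinearMap.trace k V) hsum
    rw [map_sum, LinearMap.trace_one] at h1
    simp only [htr, Finset.sum_const, Finset.card_univ, nsmul_eq_mul] at h1
    exact_mod_cast h1.symm

variable [Ring A] [Algebra k A]

theorem submodule_mul_mono_left {M N P : Submodule k A} (h : M ≤ N) : M * P ≤ N * P :=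
  mul_le_mul' h le_rfl

theorem submodule_mul_mono_right {M N P : Submodule k A} (h : M ≤ N) : P * M ≤ P * N :=
  mul_le_mul' le_rfl h

/-- A system of matrix units, not necessarily summing to one. -/
def IsMatrixUnits {A ι : Type*} [Ring A] [DecidableEq ι] (E : ι → ι → A) : Prop :=
  ∀ a b c d, E a b * E c d = if b = c then E a d else 0

variable {ι : Type*} [Fintype ι] [DecidableEq ι]

omit [Fintype ι] in
theorem IsMatrixUnits.mul_same {E : ι → ι → A} (hE : IsMatrixUnits E) (a b c : ι) :
    E a b * E b c = E a c := by simp [hE a b b c]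

/-- Left multiplication restricted to a stable subspace. -/
def restrictMulLeft (W : Submodule k A) (a : A) (h : ∀ w ∈ W, a * w ∈ W) : Module.End k W :=
  (LinearMap.mulLeft k a).restrict h

/-- Right multiplication restricted to a stable subspace. -/
def restrictMulRight (W : Submodule k A) (a : A) (h : ∀ w ∈ W, w * a ∈ W) : Module.End k W :=
  (LinearMap.mulRight k a).restrict h

@[simp] theorem restrictMulLeft_apply (W : Submodule k A) (a : A) (h : ∀ w ∈ W, a * w ∈ W) (w : W) :
    (restrictMulLeft W a h w : A) = a * w := rfl

@[simp] theorem restrictMulRight_apply (W : Submodule k A) (a : A) (h : ∀ w ∈ W, w * a ∈ W)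
    (w : W) : (restrictMulRight W a h w : A) = w * a := rfl

variable [FiniteDimensional k A]

theorem IsMatrixUnits.card_dvd_finrank_left [CharZero k] {E : ι → ι → A} (hE : IsMatrixUnits E)
    (W : Submodule k A) (hW : ∀ a b, ∀ w ∈ W, E a b * w ∈ W)
    (h1 : ∀ w ∈ W, (∑ a, E a a) * w = w) : Fintype.card ι ∣ Module.finrank k W := by
  apply card_dvd_finrank_of_idempotents fun a => restrictMulLeft W (E a a) (hW a a)
  · intro a
    ext w
    simp [← mul_assoc, hE.mul_same]
  · ext w
    simpa [Finset.sum_mul] using h1 w w.2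
  · intro a b
    refine ⟨restrictMulLeft W (E a b) (hW a b), restrictMulLeft W (E b a) (hW b a), ?_, ?_⟩ <;>
    · ext w
      simp [← mul_assoc, hE.mul_same]

theorem IsMatrixUnits.card_dvd_finrank_right [CharZero k] {E : ι → ι → A} (hE : IsMatrixUnits E)
    (W : Submodule k A) (hW : ∀ a b, ∀ w ∈ W, w * E a b ∈ W)
    (h1 : ∀ w ∈ W, w * (∑ a, E a a) = w) : Fintype.card ι ∣ Module.finrank k W := by
  apply card_dvd_finrank_of_idempotents fun a => restrictMulRight W (E a a) (hW a a)
  · intro a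
    ext w
    simp [mul_assoc, hE.mul_same]
  · ext w
    simpa [Finset.mul_sum] using h1 w w.2
  · intro a b
    refine ⟨restrictMulRight W (E b a) (hW b a), restrictMulRight W (E a b) (hW a b), ?_, ?_⟩ <;>
    · ext w
      simp [mul_assoc, hE.mul_same]

theorem IsMatrixUnits.card_sq_dvd_finrank [CharZero k] {E : ι → ι → A} (hE : IsMatrixUnits E)
    (W : Submodule k A) (hl : ∀ a b, ∀ w ∈ W, E a b * w ∈ W)
    (hr : ∀ a b, ∀ w ∈ W, w * E a b ∈ W)
    (h1 : ∀ w ∈ W, (∑ a, E a a) * w = w) (h2 : ∀ w ∈ W, w * (∑ a, E a a) = w) :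
    Fintype.card ι ^ 2 ∣ Module.finrank k W := by
  have key := card_dvd_finrank_of_idempotents (k := k) (V := W) (κ := ι × ι)
    (fun x => restrictMulLeft W (E x.1 x.1) (hl _ _) * restrictMulRight W (E x.2 x.2) (hr _ _))
    ?_ ?_ ?_
  · rwa [Fintype.card_prod, ← sq] at key
  · intro x
    ext w
    simp only [Module.End.mul_apply, restrictMulLeft_apply, restrictMulRight_apply]
    rw [mul_assoc (E x.1 x.1) _ (E x.2 x.2), mul_assoc (w : A), hE.mul_same, ← mul_assoc (E x.1 x.1),
      hE.mul_same]
  · ext w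
    have : (∑ a, E a a) * ((w : A) * ∑ a, E a a) = w := by rw [h2 _ w.2, h1 _ w.2]
    rw [Fintype.sum_prod_type]
    simpa [← Finset.sum_mul, ← Finset.mul_sum] using this
  · rintro ⟨a, b⟩ ⟨c, d⟩
    refine ⟨restrictMulLeft W (E a c) (hl _ _) * restrictMulRight W (E d b) (hr _ _),
      restrictMulLeft W (E c a) (hl _ _) * restrictMulRight W (E b d) (hr _ _), ?_, ?_⟩
    · ext w
      simp only [Module.End.mul_apply, restrictMulLeft_apply, restrictMulRight_apply]
      rw [mul_assoc (E c a) _ (E d b), mul_assoc (w : A), hE.mul_same, ← mul_assoc (E a c),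
        hE.mul_same]
    · ext w
      simp only [Module.End.mul_apply, restrictMulLeft_apply, restrictMulRight_apply]
      rw [mul_assoc (E a c) _ (E b d), mul_assoc (w : A), hE.mul_same, ← mul_assoc (E c a),
        hE.mul_same]

omit [FiniteDimensional k A] in
/-- The part `p J q` of a subspace, described by `p x = x = x q`. -/
def peirceCorner (J : Submodule k A) (p q : A) : Submodule k A where
  carrier := {x | x ∈ J ∧ p * x = x ∧ x * q = x}
  add_mem' := by
    rintro x y ⟨h1, h2, h3⟩ ⟨h4, h5, h6⟩
    exact ⟨J.add_mem h1 h4, by rw [mul_add, h2, h5], by rw [add_mul, h3, h6]⟩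
  zero_mem' := by simp
  smul_mem' := by
    rintro c x ⟨h1, h2, h3⟩
    exact ⟨J.smul_mem c h1, by rw [mul_smul_comm, h2], by rw [smul_mul_assoc, h3]⟩

omit [FiniteDimensional k A] in
theorem mem_peirceCorner {J : Submodule k A} {p q x : A} :
    x ∈ peirceCorner J p q ↔ x ∈ J ∧ p * x = x ∧ x * q = x := Iff.rfl

theorem finrank_peirce_left (W : Submodule k A) {p : A} (hp : IsIdempotentElem p)
    (hW : ∀ w ∈ W, p * w ∈ W) : Module.finrank k W =
      Module.finrank k (peirceCorner W p 1) + Module.finrank k (peirceCorner W (1 - p) 1) := by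
  rw [← Submodule.finrank_sup_add_finrank_inf_eq]
  have h1 : peirceCorner W p 1 ⊔ peirceCorner W (1 - p) 1 = W := by
    apply le_antisymm
    · exact sup_le (fun x hx => hx.1) (fun x hx => hx.1)
    · intro x hx
      rw [Submodule.mem_sup]
      refine ⟨p * x, ⟨hW x hx, by rw [← mul_assoc, hp.eq], by simp⟩, x - p * x,
        ⟨W.sub_mem hx (hW x hx), ?_, by simp⟩, by simp⟩
      rw [sub_mul, mul_sub, mul_sub, ← mul_assoc p p, hp.eq]; simp
  have h2 : peirceCorner W p 1 ⊓ peirceCorner W (1 - p) 1 = ⊥ := by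
    rw [eq_bot_iff]
    rintro x ⟨hx1, hx2⟩
    have := hx2.2.1
    rw [sub_mul, hx1.2.1] at this
    simpa using this.symm
  rw [h1, h2, finrank_bot, add_zero]

theorem finrank_peirce_right (W : Submodule k A) {p : A} (hp : IsIdempotentElem p)
    (hW : ∀ w ∈ W, w * p ∈ W) : Module.finrank k W =
      Module.finrank k (peirceCorner W 1 p) + Module.finrank k (peirceCorner W 1 (1 - p)) := by
  rw [← Submodule.finrank_sup_add_finrank_inf_eq]
  have h1 : peirceCorner W 1 p ⊔ peirceCorner W 1 (1 - p) = W := by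
    apply le_antisymm
    · exact sup_le (fun x hx => hx.1) (fun x hx => hx.1)
    · intro x hx
      rw [Submodule.mem_sup]
      refine ⟨x * p, ⟨hW x hx, by simp, by rw [mul_assoc, hp.eq]⟩, x - x * p,
        ⟨W.sub_mem hx (hW x hx), by simp, ?_⟩, by simp⟩
      rw [sub_mul, mul_sub, mul_sub, mul_assoc x p p, hp.eq]; simp
  have h2 : peirceCorner W 1 p ⊓ peirceCorner W 1 (1 - p) = ⊥ := by
    rw [eq_bot_iff]
    rintro x ⟨hx1, hx2⟩
    have := hx2.2.2
    rw [mul_sub, hx1.2.2] at this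
    simpa using this.symm
  rw [h1, h2, finrank_bot, add_zero]

theorem finrank_peirce (J : Submodule k A) {e : A} (he : IsIdempotentElem e)
    (hl : ∀ a, ∀ j ∈ J, a * j ∈ J) (hr : ∀ a, ∀ j ∈ J, j * a ∈ J) :
    Module.finrank k J = Module.finrank k (peirceCorner J e e) +
      Module.finrank k (peirceCorner J e (1 - e)) + Module.finrank k (peirceCorner J (1 - e) e) +
      Module.finrank k (peirceCorner J (1 - e) (1 - e)) := by
  have hc : ∀ p q : A, peirceCorner (peirceCorner J p 1) 1 q = peirceCorner J p q := by
    intro p q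
    ext x
    simp [mem_peirceCorner, and_assoc]
  have hs : ∀ p q : A, ∀ w ∈ peirceCorner J p 1, w * q ∈ peirceCorner J p 1 := by
    rintro p q w ⟨h1, h2, h3⟩
    exact ⟨hr q w h1, by rw [← mul_assoc, h2], by simp⟩
  rw [finrank_peirce_left J he (hl e), finrank_peirce_right (peirceCorner J e 1) he (hs e e),
    finrank_peirce_right (peirceCorner J (1 - e) 1) he (hs (1 - e) e)]
  rw [hc, hc, hc, hc]
  ring

omit [FiniteDimensional k A] in
theorem eq_bot_of_le_mul_nilpotent {W J : Submodule k A} {m : ℕ} (hJ : J ^ m = ⊥)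
    (h : W ≤ W * J) : W = ⊥ := by
  have : ∀ n, W ≤ W * J ^ n := by
    intro n
    induction n with
    | zero => simp
    | succ n ih =>
      calc W ≤ W * J := h
        _ ≤ W * J ^ n * J := submodule_mul_mono_left ih
        _ = W * J ^ (n + 1) := by rw [mul_assoc, pow_succ]
  simpa [hJ] using this m

theorem two_mul_le_finrank {W W' : Submodule k A} (hle : W' ≤ W) (hne : W' ≠ W) (h0 : W' ≠ ⊥)
    {M : ℕ} (h1 : M ∣ Module.finrank k W') (h2 : M ∣ Module.finrank k W) :
    2 * M ≤ Module.finrank k W := by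
  have hlt := Submodule.finrank_lt_finrank_of_lt (lt_of_le_of_ne hle hne)
  have hpos : 0 < Module.finrank k W' := by
    rw [Nat.pos_iff_ne_zero]
    exact fun h => h0 (Submodule.finrank_eq_zero.mp h)
  obtain ⟨s, hs⟩ := h1
  obtain ⟨t, ht⟩ := h2
  rw [hs] at hlt hpos
  rw [ht] at hlt ⊢
  have hst : s < t := lt_of_mul_lt_mul_left' hlt
  have hs0 : 0 < s := Nat.pos_of_mul_pos_left hpos
  rw [mul_comm]
  exact Nat.mul_le_mul_left _ (by omega)

omit [FiniteDimensional k A] in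
theorem peirceCorner_mul_le {J : Submodule k A} (hr : ∀ a, ∀ j ∈ J, j * a ∈ J) (p q r s : A) :
    peirceCorner J p q * peirceCorner J r s ≤ peirceCorner J p s := by
  rw [Submodule.mul_le]
  intro x hx y hy
  exact ⟨hr y x hx.1, by rw [← mul_assoc, hx.2.1], by rw [mul_assoc, hy.2.2]⟩

omit [FiniteDimensional k A] in
theorem peirceCorner_mul_eq_bot {J : Submodule k A} {p q r s : A} (hqr : q * r = 0) :
    peirceCorner J p q * peirceCorner J r s = ⊥ := by
  rw [eq_bot_iff, Submodule.mul_le]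
  intro x hx y hy
  rw [← hx.2.2, ← hy.2.1, mul_assoc, ← mul_assoc q, hqr]
  simp

omit [FiniteDimensional k A] in
theorem le_sup_peirceCorner {J : Submodule k A} {e : A} (he : IsIdempotentElem e)
    (hl : ∀ a, ∀ j ∈ J, a * j ∈ J) (hr : ∀ a, ∀ j ∈ J, j * a ∈ J) :
    J ≤ peirceCorner J e e ⊔ peirceCorner J e (1 - e) ⊔ peirceCorner J (1 - e) e ⊔
      peirceCorner J (1 - e) (1 - e) := by
  intro x hx
  have hd : x = e * x * e + e * x * (1 - e) + (1 - e) * x * e + (1 - e) * x * (1 - e) := by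
    noncomm_ring
  have hm : ∀ p q : A, IsIdempotentElem p → IsIdempotentElem q →
      p * x * q ∈ peirceCorner J p q := by
    intro p q hp hq
    exact ⟨hr _ _ (hl _ _ hx), by simp only [← mul_assoc, hp.eq], by rw [mul_assoc, hq.eq]⟩
  rw [hd]
  exact Submodule.add_mem_sup (Submodule.add_mem_sup (Submodule.add_mem_sup (hm _ _ he he)
    (hm _ _ he he.one_sub)) (hm _ _ he.one_sub he)) (hm _ _ he.one_sub he.one_sub)

/-- A nilpotent two-sided ideal `J` and an idempotent `e` that modulo `J` is the central idempotent
of the character `ε`, in an algebra whose left `ε`-integrals form a space of dimension at most one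
and coincide with the right ones. -/
structure IsUnimodularAugmentation (ε : A →ₐ[k] k) (J : Submodule k A) (e : A) : Prop where
  idem : IsIdempotentElem e
  left_mem : ∀ a j, j ∈ J → a * j ∈ J
  right_mem : ∀ a j, j ∈ J → j * a ∈ J
  nilpotent : ∃ m : ℕ, J ^ m = ⊥
  mul_sub_mem : ∀ a, a * e - ε a • e ∈ J
  sub_mul_mem : ∀ a, e * a - ε a • e ∈ J
  unique : ∀ x y : A, (∀ a, a * x = ε a • x) → (∀ a, a * y = ε a • y) → x ≠ 0 → ∃ c : k, y = c • x
  left_iff_right : ∀ x : A, (∀ a, a * x = ε a • x) ↔ (∀ a, x * a = ε a • x)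

namespace IsUnimodularAugmentation
variable {ε : A →ₐ[k] k} {J : Submodule k A} {e : A}

omit [FiniteDimensional k A] in
-- Since ae ≡ ε(a)e modulo J, anything fixed by e and killed by J is an integral.
theorem left_integral (h : IsUnimodularAugmentation ε J e) {W : Submodule k A} (hJ : J * W = ⊥)
    {x : A} (hx : x ∈ W) (hex : e * x = x) (a : A) : a * x = ε a • x := by
  have : (a * e - ε a • e) * x ∈ J * W := Submodule.mul_mem_mul (h.mul_sub_mem a) hx
  rw [hJ, Submodule.mem_bot, sub_mul, mul_assoc, hex, smul_mul_assoc, hex, sub_eq_zero] at this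
  exact this

omit [FiniteDimensional k A] in
theorem right_integral (h : IsUnimodularAugmentation ε J e) {W : Submodule k A} (hJ : W * J = ⊥)
    {x : A} (hx : x ∈ W) (hex : x * e = x) (a : A) : x * a = ε a • x := by
  have : x * (e * a - ε a • e) ∈ W * J := Submodule.mul_mem_mul hx (h.sub_mul_mem a)
  rw [hJ, Submodule.mem_bot, mul_sub, ← mul_assoc, hex, mul_smul_comm, hex, sub_eq_zero] at this
  exact this

omit [FiniteDimensional k A] in
theorem finrank_le_one (h : IsUnimodularAugmentation ε J e) {W : Submodule k A}
    (hW : ∀ x ∈ W, ∀ a, a * x = ε a • x) : Module.finrank k W ≤ 1 := by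
  by_cases h0 : W = ⊥
  · rw [h0, finrank_bot]; exact zero_le_one
  · obtain ⟨x, hx, hx0⟩ := Submodule.exists_mem_ne_zero_of_ne_bot h0
    refine _root_.finrank_le_one (⟨x, hx⟩ : W) ?_
    rintro ⟨y, hy⟩
    obtain ⟨c, hc⟩ := h.unique x y (hW x hx) (hW y hy) hx0
    exact ⟨c, Subtype.ext hc.symm⟩

omit [FiniteDimensional k A] in
-- Substituting the inclusion into itself, with YU ⊆ Y, gives U ⊆ Uⁿ⁺¹ + XY for all n, and U is
-- nilpotent.
theorem corner_le (h : IsUnimodularAugmentation ε J e)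
    (hExt : peirceCorner J e e ≤ peirceCorner J e e * peirceCorner J e e ⊔
      peirceCorner J e (1 - e) * peirceCorner J (1 - e) e) :
    peirceCorner J e e ≤ peirceCorner J e (1 - e) * peirceCorner J (1 - e) e := by
  set U := peirceCorner J e e
  set X := peirceCorner J e (1 - e)
  set Y := peirceCorner J (1 - e) e
  obtain ⟨m, hm⟩ := h.nilpotent
  have hYU : Y * U ≤ Y := peirceCorner_mul_le h.right_mem _ _ _ _
  have key : ∀ n, U ≤ U ^ (n + 1) ⊔ X * Y := by
    intro n
    induction n with
    | zero => simp
    | succ n ih =>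
      calc U ≤ U * U ⊔ X * Y := hExt
        _ ≤ (U ^ (n + 1) ⊔ X * Y) * U ⊔ X * Y := sup_le_sup_right (submodule_mul_mono_left ih) _
        _ = U ^ (n + 2) ⊔ X * (Y * U) ⊔ X * Y := by
          rw [Submodule.sup_mul, ← pow_succ, mul_assoc]
        _ ≤ _ := sup_le (sup_le le_sup_left
          ((submodule_mul_mono_right hYU).trans le_sup_right)) le_sup_right
  have hU : U ^ (m + 1) = ⊥ := by
    have : U ^ (m + 1) ≤ J ^ (m + 1) := pow_le_pow_left' (fun x hx => hx.1) _
    rw [pow_succ J, hm, Submodule.bot_mul] at this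
    exact le_bot_iff.mp this
  simpa [hU] using key m

omit [FiniteDimensional k A] in
-- With U ⊆ XY, YXY = 0 implies JU = 0 and XYX = 0 implies UJ = 0; either way U consists of
-- integrals and has dimension at most one. If ZZ = 0, then YXYX = 0 because YX ⊆ Z, so XYX consists
-- of left integrals.
theorem triple_products_ne_bot (h : IsUnimodularAugmentation ε J e)
    (hExt : peirceCorner J e e ≤ peirceCorner J e e * peirceCorner J e e ⊔
      peirceCorner J e (1 - e) * peirceCorner J (1 - e) e)
    (hU : 2 ≤ Module.finrank k (peirceCorner J e e)) :
    peirceCorner J (1 - e) e * peirceCorner J e (1 - e) * peirceCorner J (1 - e) e ≠ ⊥ ∧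
    peirceCorner J e (1 - e) * peirceCorner J (1 - e) e * peirceCorner J e (1 - e) ≠ ⊥ ∧
    peirceCorner J (1 - e) (1 - e) * peirceCorner J (1 - e) (1 - e) ≠ ⊥ := by
  have hUXY := h.corner_le hExt
  have hJ := le_sup_peirceCorner h.idem h.left_mem h.right_mem
  have hef : e * (1 - e) = 0 := by rw [mul_sub, h.idem.eq]; simp
  have hfe : (1 - e) * e = 0 := by rw [sub_mul, h.idem.eq]; simp
  have hXX : peirceCorner J e (1 - e) * peirceCorner J e (1 - e) = ⊥ :=
    peirceCorner_mul_eq_bot hfe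
  have hZX : peirceCorner J (1 - e) (1 - e) * peirceCorner J e (1 - e) = ⊥ :=
    peirceCorner_mul_eq_bot hfe
  have hYY : peirceCorner J (1 - e) e * peirceCorner J (1 - e) e = ⊥ :=
    peirceCorner_mul_eq_bot hef
  have hYZ : peirceCorner J (1 - e) e * peirceCorner J (1 - e) (1 - e) = ⊥ :=
    peirceCorner_mul_eq_bot hef
  have hYX : peirceCorner J (1 - e) e * peirceCorner J e (1 - e) ≤
      peirceCorner J (1 - e) (1 - e) := peirceCorner_mul_le h.right_mem _ _ _ _
  have hXYX_le : peirceCorner J e (1 - e) * peirceCorner J (1 - e) e * peirceCorner J e (1 - e) ≤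
      peirceCorner J e (1 - e) :=
    (submodule_mul_mono_left (peirceCorner_mul_le h.right_mem _ _ _ _)).trans
      (peirceCorner_mul_le h.right_mem _ _ _ _)
  have hUmem : ∀ x ∈ peirceCorner J e e, e * x = x ∧ x * e = x := fun x hx => hx.2
  have hXmem : ∀ x ∈ peirceCorner J e (1 - e), e * x = x ∧ x * (1 - e) = x := fun x hx => hx.2
  set U := peirceCorner J e e
  set X := peirceCorner J e (1 - e)
  set Y := peirceCorner J (1 - e) e
  set Z := peirceCorner J (1 - e) (1 - e)
  have hA : Y * X * Y ≠ ⊥ := by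
    intro hbot
    have hJU : J * U = ⊥ := by
      rw [eq_bot_iff]
      calc J * U ≤ (U ⊔ X ⊔ Y ⊔ Z) * (X * Y) := mul_le_mul' hJ hUXY
        _ ≤ ((X * Y) ⊔ X ⊔ Y ⊔ Z) * (X * Y) := submodule_mul_mono_left
            (sup_le_sup_right (sup_le_sup_right (sup_le_sup_right hUXY _) _) _)
        _ = X * (Y * X * Y) ⊔ X * X * Y ⊔ Y * X * Y ⊔ Z * X * Y := by
            simp only [Submodule.sup_mul, mul_assoc]
        _ ≤ ⊥ := by simp [hbot, hXX, hZX]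
    have := h.finrank_le_one fun x hx => h.left_integral hJU hx (hUmem x hx).1
    omega
  have hB : X * Y * X ≠ ⊥ := by
    intro hbot
    have hUJ : U * J = ⊥ := by
      rw [eq_bot_iff]
      calc U * J ≤ (X * Y) * (U ⊔ X ⊔ Y ⊔ Z) := mul_le_mul' hUXY hJ
        _ ≤ (X * Y) * ((X * Y) ⊔ X ⊔ Y ⊔ Z) := submodule_mul_mono_right
            (sup_le_sup_right (sup_le_sup_right (sup_le_sup_right hUXY _) _) _)
        _ = X * Y * X * Y ⊔ X * Y * X ⊔ X * (Y * Y) ⊔ X * (Y * Z) := by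
            simp only [Submodule.mul_sup, mul_assoc]
        _ ≤ ⊥ := by simp [hbot, hYY, hYZ]
    have := h.finrank_le_one fun x hx =>
      (h.left_iff_right x).mpr (h.right_integral hUJ hx (hUmem x hx).2)
    omega
  refine ⟨hA, hB, fun hbot => hB ?_⟩
  have hYXYX : Y * X * (Y * X) = ⊥ := by
    rw [eq_bot_iff, ← hbot]
    exact mul_le_mul' hYX hYX
  have hJW : J * (X * Y * X) = ⊥ := by
    rw [eq_bot_iff]
    calc J * (X * Y * X) ≤ (U ⊔ X ⊔ Y ⊔ Z) * (X * Y * X) := submodule_mul_mono_left hJ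
      _ ≤ ((X * Y) ⊔ X ⊔ Y ⊔ Z) * (X * Y * X) := submodule_mul_mono_left
          (sup_le_sup_right (sup_le_sup_right (sup_le_sup_right hUXY _) _) _)
      _ = X * (Y * X * (Y * X)) ⊔ X * X * (Y * X) ⊔ Y * X * (Y * X) ⊔ Z * X * (Y * X) := by
          simp only [Submodule.sup_mul, mul_assoc]
      _ ≤ ⊥ := by simp [hYXYX, hXX, hZX]
  rw [eq_bot_iff]
  intro x hx
  obtain ⟨h1, h2⟩ := hXmem x (hXYX_le hx)
  have hl := h.left_integral hJW hx h1
  -- A nonzero x here forces ε(e) = 1, so as a right integral it is killed by 1 - e; but x(1 - e) =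
  -- x.
  have hr := (h.left_iff_right x).mp hl (1 - e)
  rw [h2] at hr
  have hee : e * x = ε e • x := hl e
  rw [h1] at hee
  by_contra hx0
  rw [Submodule.mem_bot] at hx0
  have : (ε e - 1) • x = 0 := by rw [sub_smul, ← hee]; simp
  have h3 : ε e = 1 := sub_eq_zero.mp ((smul_eq_zero.mp this).resolve_right hx0)
  rw [map_sub, map_one, h3, sub_self, zero_smul] at hr
  exact hx0 hr

/-- Each of X, Y and Z properly contains a nonzero subspace stable under the same matrix units, so
its dimension is at least twice the divisor. -/
theorem finrank_ge [CharZero k] (h : IsUnimodularAugmentation ε J e) {E : ι → ι → A}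
    (hE : IsMatrixUnits E) (hsum : ∑ a, E a a = 1 - e)
    (hExt : peirceCorner J e e ≤ peirceCorner J e e * peirceCorner J e e ⊔
      peirceCorner J e (1 - e) * peirceCorner J (1 - e) e)
    (hU : 2 ≤ Module.finrank k (peirceCorner J e e)) :
    Module.finrank k (peirceCorner J e e) + 4 * Fintype.card ι + 2 * Fintype.card ι ^ 2 ≤
      Module.finrank k J := by
  obtain ⟨hA, hB, hC⟩ := h.triple_products_ne_bot hExt hU
  obtain ⟨m, hm⟩ := h.nilpotent
  have hEl : ∀ a b, (1 - e) * E a b = E a b := by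
    intro a b
    rw [← hsum, Finset.sum_mul, Finset.sum_eq_single a]
    · exact hE.mul_same _ _ _
    · intro c _ hc; rw [hE]; simp [hc]
    · simp
  have hEr : ∀ a b, E a b * (1 - e) = E a b := by
    intro a b
    rw [← hsum, Finset.mul_sum, Finset.sum_eq_single b]
    · exact hE.mul_same _ _ _
    · intro c _ hc; rw [hE]; simp [hc.symm]
    · simp
  have hle : ∀ p q, peirceCorner J p q ≤ J := fun p q x hx => hx.1
  have hYl : ∀ q a b, ∀ w ∈ peirceCorner J (1 - e) q, E a b * w ∈ peirceCorner J (1 - e) q :=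
    fun q a b w hw => ⟨h.left_mem _ _ hw.1, by rw [← mul_assoc, hEl], by rw [mul_assoc, hw.2.2]⟩
  have hXr : ∀ p a b, ∀ w ∈ peirceCorner J p (1 - e), w * E a b ∈ peirceCorner J p (1 - e) :=
    fun p a b w hw => ⟨h.right_mem _ _ hw.1, by rw [← mul_assoc, hw.2.1], by rw [mul_assoc, hEr]⟩
  have mul_left_stable : ∀ {V W : Submodule k A}, (∀ a b, ∀ w ∈ V, E a b * w ∈ V) →
      ∀ a b, ∀ w ∈ V * W, E a b * w ∈ V * W := by
    intro V W hV a b w hw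
    induction hw using Submodule.mul_induction_on' with
    | mem_mul_mem x hx y hy => rw [← mul_assoc]; exact Submodule.mul_mem_mul (hV a b x hx) hy
    | add x _ y _ hx hy => rw [mul_add]; exact Submodule.add_mem _ hx hy
  have mul_right_stable : ∀ {V W : Submodule k A}, (∀ a b, ∀ w ∈ W, w * E a b ∈ W) →
      ∀ a b, ∀ w ∈ V * W, w * E a b ∈ V * W := by
    intro V W hV a b w hw
    induction hw using Submodule.mul_induction_on' with
    | mem_mul_mem x hx y hy => rw [mul_assoc]; exact Submodule.mul_mem_mul hx (hV a b y hy)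
    | add x _ y _ hx hy => rw [add_mul]; exact Submodule.add_mem _ hx hy
  have hX := hXr e
  have hY := hYl e
  have hZl := hYl (1 - e)
  have hZr := hXr (1 - e)
  have hX1 : ∀ w ∈ peirceCorner J e (1 - e), w * (∑ a, E a a) = w := fun w hw => by
    rw [hsum, hw.2.2]
  have hY1 : ∀ w ∈ peirceCorner J (1 - e) e, (∑ a, E a a) * w = w := fun w hw => by
    rw [hsum, hw.2.1]
  have hZ1 : ∀ w ∈ peirceCorner J (1 - e) (1 - e), (∑ a, E a a) * w = w := fun w hw => by
    rw [hsum, hw.2.1]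
  have hZ2 : ∀ w ∈ peirceCorner J (1 - e) (1 - e), w * (∑ a, E a a) = w := fun w hw => by
    rw [hsum, hw.2.2]
  have hXYX_le : peirceCorner J e (1 - e) * peirceCorner J (1 - e) e * peirceCorner J e (1 - e) ≤
      peirceCorner J e (1 - e) :=
    (submodule_mul_mono_left (peirceCorner_mul_le h.right_mem _ _ _ _)).trans
      (peirceCorner_mul_le h.right_mem _ _ _ _)
  have hYXY_le : peirceCorner J (1 - e) e * peirceCorner J e (1 - e) * peirceCorner J (1 - e) e ≤
      peirceCorner J (1 - e) e :=
    (submodule_mul_mono_left (peirceCorner_mul_le h.right_mem _ _ _ _)).trans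
      (peirceCorner_mul_le h.right_mem _ _ _ _)
  have hZZ_le : peirceCorner J (1 - e) (1 - e) * peirceCorner J (1 - e) (1 - e) ≤
      peirceCorner J (1 - e) (1 - e) := peirceCorner_mul_le h.right_mem _ _ _ _
  have hYX_le : peirceCorner J (1 - e) e * peirceCorner J e (1 - e) ≤ J :=
    (peirceCorner_mul_le h.right_mem _ _ _ _).trans (hle _ _)
  have hXY_le : peirceCorner J e (1 - e) * peirceCorner J (1 - e) e ≤ J :=
    (peirceCorner_mul_le h.right_mem _ _ _ _).trans (hle _ _)
  have hZ_le := hle (1 - e) (1 - e)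
  rw [finrank_peirce J h.idem h.left_mem h.right_mem]
  set U := peirceCorner J e e
  set X := peirceCorner J e (1 - e)
  set Y := peirceCorner J (1 - e) e
  set Z := peirceCorner J (1 - e) (1 - e)
  have dX : 2 * Fintype.card ι ≤ Module.finrank k X := by
    -- The inclusion is proper: X = XYX would give X ⊆ XJ, hence X = 0 as J is nilpotent.
    refine two_mul_le_finrank hXYX_le (fun heq => hB ?_) hB
      (hE.card_dvd_finrank_right _ (mul_right_stable hX) fun w hw => hX1 w (hXYX_le hw))
      (hE.card_dvd_finrank_right _ hX hX1)
    rw [heq]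
    refine eq_bot_of_le_mul_nilpotent hm ?_
    conv_lhs => rw [← heq, mul_assoc]
    exact submodule_mul_mono_right hYX_le
  have dY : 2 * Fintype.card ι ≤ Module.finrank k Y := by
    refine two_mul_le_finrank hYXY_le (fun heq => hA ?_) hA
      (hE.card_dvd_finrank_left _ (mul_left_stable (mul_left_stable hY))
        fun w hw => hY1 w (hYXY_le hw))
      (hE.card_dvd_finrank_left _ hY hY1)
    rw [heq]
    refine eq_bot_of_le_mul_nilpotent hm ?_
    conv_lhs => rw [← heq, mul_assoc]
    exact submodule_mul_mono_right hXY_le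
  have dZ : 2 * Fintype.card ι ^ 2 ≤ Module.finrank k Z := by
    refine two_mul_le_finrank hZZ_le (fun heq => hC ?_) hC
      (hE.card_sq_dvd_finrank _ (mul_left_stable hZl) (mul_right_stable hZr)
        (fun w hw => hZ1 w (hZZ_le hw)) fun w hw => hZ2 w (hZZ_le hw))
      (hE.card_sq_dvd_finrank _ hZl hZr hZ1 hZ2)
    rw [heq]
    refine eq_bot_of_le_mul_nilpotent hm ?_
    conv_lhs => rw [← heq]
    exact submodule_mul_mono_right hZ_le
  omega

theorem finrank_modEq [CharZero k] (h : IsUnimodularAugmentation ε J e) {E : ι → ι → A}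
    (hE : IsMatrixUnits E) (hsum : ∑ a, E a a = 1 - e) :
    Module.finrank k J ≡ Module.finrank k (peirceCorner J e e) [MOD Fintype.card ι] := by
  have hEl : ∀ a b, (1 - e) * E a b = E a b := by
    intro a b
    rw [← hsum, Finset.sum_mul, Finset.sum_eq_single a]
    · exact hE.mul_same _ _ _
    · intro c _ hc; rw [hE]; simp [hc]
    · simp
  have hEr : ∀ a b, E a b * (1 - e) = E a b := by
    intro a b
    rw [← hsum, Finset.mul_sum, Finset.sum_eq_single b]
    · exact hE.mul_same _ _ _
    · intro c _ hc; rw [hE]; simp [hc.symm]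
    · simp
  have hYl : ∀ q, Fintype.card ι ∣ Module.finrank k (peirceCorner J (1 - e) q) := fun q =>
    hE.card_dvd_finrank_left _ (fun a b w hw => ⟨h.left_mem _ _ hw.1, by rw [← mul_assoc, hEl],
      by rw [mul_assoc, hw.2.2]⟩) fun w hw => by rw [hsum, hw.2.1]
  have hXr : Fintype.card ι ∣ Module.finrank k (peirceCorner J e (1 - e)) :=
    hE.card_dvd_finrank_right _ (fun a b w hw => ⟨h.right_mem _ _ hw.1,
      by rw [← mul_assoc, hw.2.1], by rw [mul_assoc, hEr]⟩) fun w hw => by rw [hsum, hw.2.2]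
  rw [finrank_peirce J h.idem h.left_mem h.right_mem, add_assoc, add_assoc]
  have := (dvd_add hXr (dvd_add (hYl e) (hYl (1 - e)))).modEq_zero_nat
  simpa using (Nat.ModEq.refl (Module.finrank k (peirceCorner J e e))).add this

end IsUnimodularAugmentation
end RingTheory

/-! ### Semisimple quotient, characters and lifting of matrix units -/

section Wedderburn
variable {k A : Type*} [Field k] [Ring A] [Algebra k A] [FiniteDimensional k A]

theorem exists_surjective_algHom_pi_matrix [IsAlgClosed k] :
    ∃ (n : ℕ) (d : Fin n → ℕ) (φ : A →ₐ[k] Π i, Matrix (Fin (d i)) (Fin (d i)) k),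
      (∀ i, d i ≠ 0) ∧ Function.Surjective φ ∧
        ∃ m : ℕ, (LinearMap.ker φ.toLinearMap) ^ m = ⊥ := by
  have : IsArtinianRing A := IsArtinianRing.of_finite k A
  obtain ⟨n, d, hd, ⟨f⟩⟩ := IsSemisimpleRing.exists_algEquiv_pi_matrix_of_isAlgClosed k
    (A ⧸ Ring.jacobson A)
  obtain ⟨m, hm⟩ := IsSemiprimaryRing.isNilpotent (R := A)
  let φ := f.toAlgHom.comp (Ideal.Quotient.mkₐ k (Ring.jacobson A))
  refine ⟨n, d, φ, fun i => (hd i).ne,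
    f.surjective.comp (Ideal.Quotient.mkₐ_surjective k _), m + 1, ?_⟩
  have hker : LinearMap.ker φ.toLinearMap ≤ (Ring.jacobson A).restrictScalars k := by
    intro x hx
    have h1 : f (Ideal.Quotient.mk (Ring.jacobson A) x) = 0 := hx
    rw [map_eq_zero_iff f f.injective] at h1
    exact Ideal.Quotient.eq_zero_iff_mem.mp h1
  have hpow : ∀ m, (LinearMap.ker φ.toLinearMap) ^ (m + 1) ≤
      ((Ring.jacobson A) ^ (m + 1)).restrictScalars k := by
    intro m
    induction m with
    | zero =>
      rw [zero_add, pow_one, Submodule.pow_one]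
      exact hker
    | succ m ih =>
      rw [pow_succ, Submodule.mul_le]
      intro x hx y hy
      rw [Submodule.restrictScalars_mem, (Ring.jacobson A).pow_succ]
      exact Ideal.mul_mem_mul (ih hx) (hker hy)
  have hz : (Ring.jacobson A) ^ (m + 1) = ⊥ := by
    rw [eq_bot_iff, ← Ideal.zero_eq_bot, ← hm]
    exact Ideal.pow_le_pow_right (Nat.le_succ m)
  rw [eq_bot_iff]
  intro x hx
  have := hpow m hx
  rw [hz] at this
  simpa using this

omit [FiniteDimensional k A] in
-- Simplicity of the matrix algebra: from a nonzero entry of φ(a), the products E_{tr} a E_{st}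
-- rebuild the identity.
theorem exists_mem_map_eq_one {d : ℕ} {φ : A →ₐ[k] Matrix (Fin d) (Fin d) k}
    (hφ : Function.Surjective φ) {I : Submodule k A} (hl : ∀ a, ∀ i ∈ I, a * i ∈ I)
    (hr : ∀ a, ∀ i ∈ I, i * a ∈ I) : I ≤ LinearMap.ker φ.toLinearMap ∨ ∃ a ∈ I, φ a = 1 := by
  by_contra! hcon
  obtain ⟨h1, h2⟩ := hcon
  obtain ⟨a, ha, hne⟩ := Set.not_subset.mp h1
  have hne' : φ a ≠ 0 := hne
  obtain ⟨r, s, hrs⟩ : ∃ r s, φ a r s ≠ 0 := by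
    by_contra! h
    exact hne' (by ext r s; exact h r s)
  choose E hE using fun p q => hφ (Matrix.single p q (1 : k))
  refine h2 ((φ a r s)⁻¹ • ∑ t, E t r * a * E s t) (I.smul_mem _ (I.sum_mem fun t _ =>
    hr _ _ (hl _ _ ha))) ?_
  rw [map_smul, map_sum]
  have : ∀ t, φ (E t r * a * E s t) = φ a r s • Matrix.single t t 1 := by
    intro t
    rw [map_mul, map_mul, hE, hE, Matrix.single_mul_mul_single]
    simp
  simp only [this]
  rw [← Finset.smul_sum, smul_smul, inv_mul_cancel₀ hrs, one_smul, Matrix.sum_single_one]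

omit [FiniteDimensional k A] in
theorem exists_character_factor {n : ℕ} {d : Fin n → ℕ}
    {φ : A →ₐ[k] Π i, Matrix (Fin (d i)) (Fin (d i)) k} (hφ : Function.Surjective φ)
    {m : ℕ} (hm : (LinearMap.ker φ.toLinearMap) ^ m = ⊥) (α : A →ₐ[k] k) :
    ∃ i, ∀ a, φ a i = 0 → α a = 0 := by
  have hker : ∀ x, φ x = 0 → α x = 0 := by
    intro x hx
    have h1 : x ^ m ∈ (LinearMap.ker φ.toLinearMap) ^ m := Submodule.pow_mem_pow _ hx _
    rw [hm, Submodule.mem_bot] at h1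
    have h2 := congrArg α h1
    rw [map_pow, map_zero] at h2
    exact IsNilpotent.eq_zero ⟨m, h2⟩
  choose z hz using fun i => hφ (Pi.single i 1)
  have h1 : α (∑ i, z i) = 1 := by
    have : α (∑ i, z i - 1) = 0 := by
      apply hker
      rw [map_sub, map_sum, map_one]
      simp only [hz]
      rw [Finset.univ_sum_single (fun i => (1 : Matrix (Fin (d i)) (Fin (d i)) k))]
      exact sub_self _
    rwa [map_sub, map_one, sub_eq_zero] at this
  rw [map_sum] at h1
  obtain ⟨i, _, hi⟩ := Finset.exists_ne_zero_of_sum_ne_zero (h1.trans_ne one_ne_zero)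
  refine ⟨i, fun a ha => ?_⟩
  have h2 : α (a * z i) = 0 := by
    apply hker
    rw [map_mul, hz]
    ext j
    rw [Pi.mul_apply]
    by_cases hj : j = i
    · subst hj; simp [ha]
    · simp [Pi.single_eq_of_ne hj]
  rw [map_mul] at h2
  exact (mul_eq_zero.mp h2).resolve_right hi

theorem character_eq_of_factor {d : ℕ} {φ : A →ₐ[k] Matrix (Fin d) (Fin d) k}
    (hφ : Function.Surjective φ) {α : A →ₐ[k] k} (h : ∀ a, φ a = 0 → α a = 0) :
    d = 1 ∧ ∀ a, φ a = α a • 1 := by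
  have hle : LinearMap.ker α.toLinearMap ≤ LinearMap.ker φ.toLinearMap := by
    refine (exists_mem_map_eq_one hφ ?_ ?_).resolve_right ?_
    · intro a i hi
      have : α i = 0 := hi
      simp [this]
    · intro a i hi
      have : α i = 0 := hi
      simp [this]
    · rintro ⟨a, ha, h1⟩
      have ha' : α a = 0 := ha
      have := h (a - 1) (by rw [map_sub, h1, map_one, sub_self])
      rw [map_sub, ha', map_one] at this
      simp at this
  have heq : LinearMap.ker α.toLinearMap = LinearMap.ker φ.toLinearMap :=
    le_antisymm hle fun a ha => h a ha
  constructor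
  · have h1 := LinearMap.finrank_range_add_finrank_ker α.toLinearMap
    have h2 := LinearMap.finrank_range_add_finrank_ker φ.toLinearMap
    have hα : Function.Surjective α := fun c => ⟨algebraMap k A c, by simp⟩
    rw [LinearMap.range_eq_top.mpr hα, finrank_top, Module.finrank_self, heq] at h1
    rw [LinearMap.range_eq_top.mpr hφ, finrank_top, Module.finrank_matrix] at h2
    simp only [Fintype.card_fin, Module.finrank_self, mul_one] at h2
    have : d * d = 1 := by omega
    exact Nat.eq_one_of_mul_eq_one_right this
  · intro a
    have : a - α a • 1 ∈ LinearMap.ker φ.toLinearMap := hle (by simp)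
    have h3 : φ (a - α a • 1) = 0 := this
    rwa [map_sub, map_smul, map_one, sub_eq_zero] at h3

theorem exists_matrixUnits_of_dvd {N d : ℕ} (h : N ∣ d) :
    ∃ G : Fin N → Fin N → Matrix (Fin d) (Fin d) k, IsMatrixUnits G ∧ ∑ a, G a a = 1 := by
  obtain ⟨m, rfl⟩ := h
  let r := Matrix.reindexAlgEquiv k k (finProdFinEquiv (m := N) (n := m))
  refine ⟨fun a b => r (Matrix.kroneckerMap (· * ·) (Matrix.single a b (1 : k))
    (1 : Matrix (Fin m) (Fin m) k)), ?_, ?_⟩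
  · intro a b c d
    rw [← map_mul, ← Matrix.mul_kronecker_mul, one_mul]
    split_ifs with hbc
    · subst hbc; rw [Matrix.single_mul_single_same, one_mul]
    · rw [Matrix.single_mul_single_of_ne _ _ _ _ hbc]; simp
  · rw [← map_sum]
    have : ∑ a : Fin N, Matrix.kroneckerMap (· * ·) (Matrix.single a a (1 : k))
        (1 : Matrix (Fin m) (Fin m) k) = 1 := by
      rw [← Matrix.one_kronecker_one]
      conv_rhs => rw [← Matrix.sum_single_one (m := Fin N)]
      ext ⟨i, i'⟩ ⟨j, j'⟩
      simp [Matrix.sum_apply, Finset.sum_mul]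
    rw [this, map_one]

/-- Lift the orthogonal diagonal idempotents, then a column `u` and a row `v` of the system through
a fixed index o. The products v_a u_a equal f_o up to a nilpotent, which an inverse corrects. -/
theorem exists_lift_matrixUnits {A B ι : Type*} [Ring A] [Ring B] [Fintype ι] [DecidableEq ι]
    (π : A →+* B) (hπ : Function.Surjective π) (hker : ∀ x, π x = 0 → IsNilpotent x)
    {G : ι → ι → B} (hG : IsMatrixUnits G) :
    ∃ E : ι → ι → A, IsMatrixUnits E ∧ ∀ a b, π (E a b) = G a b := by
  rcases isEmpty_or_nonempty ι with hι | ⟨⟨o⟩⟩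
  · exact ⟨fun a => hι.elim a, fun a => hι.elim a, fun a => hι.elim a⟩
  obtain ⟨f, hf, hfG⟩ := OrthogonalIdempotents.lift_of_isNilpotent_ker π
    (fun x hx => hker x hx) (e := fun a => G a a)
    ⟨fun a => hG.mul_same a a a, fun a b hab => by simp [hG a a b b, hab]⟩ (fun a => hπ _)
  have hfG' : ∀ a, π (f a) = G a a := fun a => congrFun hfG a
  have hfm := hf.mul_eq
  choose g hg using fun a b => hπ (G a b)
  let u : ι → A := fun a => f a * g a o * f o
  let v : ι → A := fun a => f o * g o a * f a
  have hu : ∀ a, π (u a) = G a o := fun a => by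
    simp [u, hfG', hg, hG.mul_same]
  have hv : ∀ a, π (v a) = G o a := fun a => by
    simp [v, hfG', hg, hG.mul_same]
  have hfo : f o * f o = f o := hf.idem o
  have hnil : ∀ a, IsNilpotent (f o - v a * u a) := fun a =>
    hker _ (by simp [hu, hv, hfG', hG.mul_same])
  choose w hw using fun a => (hnil a).isUnit_one_sub.exists_left_inv
  have hfu : ∀ a, f a * u a = u a := fun a => by
    simp only [u, ← mul_assoc]; rw [(hf.idem a).eq]
  have huf : ∀ a, u a * f o = u a := fun a => by
    simp only [u, mul_assoc]; rw [hfo]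
  have hvf : ∀ a, v a * f a = v a := fun a => by
    simp only [v, mul_assoc]; rw [(hf.idem a).eq]
  have hvu : ∀ a, f o * w a * v a * u a = f o := by
    intro a
    have h1 : v a * u a = (1 - (f o - v a * u a)) * f o := by
      rw [sub_mul, sub_mul, mul_assoc (v a) (u a) (f o), huf, hfo]; simp
    calc f o * w a * v a * u a = f o * w a * (v a * u a) := by rw [mul_assoc]
      _ = f o * (w a * (1 - (f o - v a * u a))) * f o := by
        conv_lhs => rw [h1]
        simp only [mul_assoc]
      _ = f o := by rw [hw, mul_one, hfo]
  have hπw : ∀ a, π (w a) = 1 := by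
    intro a
    have := congrArg π (hw a)
    simpa [hu, hv, hfG', hG.mul_same] using this
  -- The row `v` is replaced by f_o w_b v_b, which by `hvu` is an exact left inverse of u_b in the
  -- corner at o.
  refine ⟨fun a b => u a * (f o * w b * v b), ?_, ?_⟩
  · intro a b c d
    calc u a * (f o * w b * v b) * (u c * (f o * w d * v d))
        = u a * (f o * w b * (v b * u c)) * (f o * w d * v d) := by simp only [mul_assoc]
      _ = _ := ?_
    split_ifs with hbc
    · subst hbc
      rw [← mul_assoc (f o * w b), hvu, huf]
    · rw [← hvf b, ← hfu c, mul_assoc (v b), ← mul_assoc (f b), hfm]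
      simp [hbc]
  · intro a b
    simp [hu, hv, hfG', hπw, hG.mul_same]

end Wedderburn

/-! ### Duality between ideals of A and subcoalgebras of H -/

section Duality
variable {k H : Type*} [Field k] [AddCommGroup H] [Module k H]

/-- The elements of `H` killed by all functionals in `I`. -/
def dualPerp (I : Submodule k (WithConv (H →ₗ[k] k))) : Submodule k H where
  carrier := {h | ∀ a ∈ I, a h = 0}
  add_mem' := fun {x y} hx hy a ha => by rw [map_add, hx a ha, hy a ha, add_zero]
  zero_mem' := fun a _ => map_zero _
  smul_mem' := fun c x hx a ha => by rw [map_smul, hx a ha, smul_zero]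

/-- The functionals vanishing on `C`. -/
def dualAnnih (C : Submodule k H) : Submodule k (WithConv (H →ₗ[k] k)) where
  carrier := {a | ∀ h ∈ C, a h = 0}
  add_mem' := fun {x y} hx hy h hh => by simp [hx h hh, hy h hh]
  zero_mem' := fun h _ => by simp
  smul_mem' := fun c x hx h hh => by simp [hx h hh]

theorem mem_dualPerp {I : Submodule k (WithConv (H →ₗ[k] k))} {h : H} :
    h ∈ dualPerp I ↔ ∀ a ∈ I, a h = 0 := Iff.rfl

theorem dualPerp_eq (I : Submodule k (WithConv (H →ₗ[k] k))) : dualPerp I =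
    (I.map (WithConv.linearEquiv k (H →ₗ[k] k)).toLinearMap :
      Submodule k (Module.Dual k H)).dualCoannihilator := by
  ext h
  rw [mem_dualPerp, Submodule.mem_dualCoannihilator]
  constructor
  · rintro hh _ ⟨a, ha, rfl⟩
    exact hh a ha
  · intro hh a ha
    exact hh _ ⟨a, ha, rfl⟩

theorem dualPerp_anti {I I' : Submodule k (WithConv (H →ₗ[k] k))} (h : I ≤ I') :
    dualPerp I' ≤ dualPerp I := fun _ hx a ha => hx a (h ha)

theorem dualPerp_dualAnnih (C : Submodule k H) : dualPerp (dualAnnih C) = C := by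
  apply le_antisymm
  · intro h hh
    by_contra hC
    obtain ⟨f, hf, hle⟩ := Submodule.exists_le_ker_of_notMem hC
    exact hf (hh (toConv f) fun x hx => hle hx)
  · exact fun h hh a ha => ha h hh

variable [FiniteDimensional k H]

theorem finrank_dualPerp (I : Submodule k (WithConv (H →ₗ[k] k))) :
    Module.finrank k I + Module.finrank k (dualPerp I) = Module.finrank k H := by
  rw [dualPerp_eq, ← Subspace.finrank_add_finrank_dualCoannihilator_eq
    (I.map (WithConv.linearEquiv k (H →ₗ[k] k)).toLinearMap : Submodule k (Module.Dual k H))]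
  congr 1
  exact ((WithConv.linearEquiv k (H →ₗ[k] k)).submoduleMap I).finrank_eq

theorem dualAnnih_dualPerp (I : Submodule k (WithConv (H →ₗ[k] k))) :
    dualAnnih (dualPerp I) = I := by
  have hle : I ≤ dualAnnih (dualPerp I) := fun a ha h hh => hh a ha
  have : FiniteDimensional k (WithConv (H →ₗ[k] k)) :=
    Module.Finite.equiv (WithConv.linearEquiv k (H →ₗ[k] k)).symm
  refine (Submodule.eq_of_le_of_finrank_eq hle ?_).symm
  have h1 := finrank_dualPerp I
  have h2 := finrank_dualPerp (dualAnnih (dualPerp I))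
  rw [dualPerp_dualAnnih] at h2
  omega

theorem exists_eval_eq (δ : WithConv (H →ₗ[k] k) →ₗ[k] k) : ∃ x : H, ∀ a, δ a = a x := by
  obtain ⟨x, hx⟩ := (Module.evalEquiv k H).surjective
    (δ ∘ₗ (WithConv.linearEquiv k (H →ₗ[k] k)).symm.toLinearMap)
  refine ⟨x, fun a => ?_⟩
  have := congr($hx a.ofConv)
  simpa using this.symm

variable [Coalgebra k H]

omit [FiniteDimensional k H] in
theorem IsSubcoalgebra.mul_mem {C : Submodule k H} (hC : IsSubcoalgebra C)
    (c a : WithConv (H →ₗ[k] k)) (ha : a ∈ dualAnnih C) : c * a ∈ dualAnnih C := by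
  intro h hh
  obtain ⟨t, ht⟩ := hC h hh
  have h0 : a.ofConv ∘ₗ C.subtype = 0 := by
    ext x
    exact ha x x.2
  rw [LinearMap.convMul_apply, ← ht, ← LinearMap.comp_apply (TensorProduct.map _ _),
    ← TensorProduct.map_comp, h0, TensorProduct.map_zero_right]
  simp

omit [FiniteDimensional k H] in
theorem IsSubcoalgebra.mul_mem' {C : Submodule k H} (hC : IsSubcoalgebra C)
    (c a : WithConv (H →ₗ[k] k)) (ha : a ∈ dualAnnih C) : a * c ∈ dualAnnih C := by
  intro h hh
  obtain ⟨t, ht⟩ := hC h hh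
  have h0 : a.ofConv ∘ₗ C.subtype = 0 := by
    ext x
    exact ha x x.2
  rw [LinearMap.convMul_apply, ← ht, ← LinearMap.comp_apply (TensorProduct.map _ _),
    ← TensorProduct.map_comp, h0, TensorProduct.map_zero_left]
  simp

/-- For a linear projection P onto the annihilator, a - a ∘ P lies in I, so the ideal property gives
(P ⊗ P)Δ = Δ there. -/
theorem isSubcoalgebra_dualPerp {I : Submodule k (WithConv (H →ₗ[k] k))}
    (hl : ∀ a, ∀ i ∈ I, a * i ∈ I) (hr : ∀ a, ∀ i ∈ I, i * a ∈ I) :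
    IsSubcoalgebra (dualPerp I) := by
  intro h hh
  obtain ⟨p, hp⟩ := (dualPerp I).subtype.exists_leftInverse_of_injective (Submodule.ker_subtype _)
  have hpx : ∀ x ∈ dualPerp I, (p x : H) = x := by
    intro x hx
    have := congr($hp ⟨x, hx⟩)
    exact congrArg Subtype.val this
  set P : H →ₗ[k] H := (dualPerp I).subtype ∘ₗ p
  have hmem : ∀ a : WithConv (H →ₗ[k] k), a - toConv (a.ofConv ∘ₗ P) ∈ I := by
    intro a
    rw [← dualAnnih_dualPerp I]
    intro x hx
    simp [P, hpx x hx]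
  refine ⟨TensorProduct.map p p (comul h), ?_⟩
  apply tensorProduct_ext_dual
  intro a c
  have h1 : (toConv a * toConv c : WithConv (H →ₗ[k] k)) h =
      (toConv (a ∘ₗ P) * toConv (c ∘ₗ P) : WithConv (H →ₗ[k] k)) h := by
    rw [← sub_eq_zero, ← LinearMap.sub_apply, ← ofConv_sub]
    refine hh _ ?_
    have : (toConv a * toConv c - toConv (a ∘ₗ P) * toConv (c ∘ₗ P) : WithConv (H →ₗ[k] k)) =
        (toConv a - toConv (a ∘ₗ P)) * toConv c +
          toConv (a ∘ₗ P) * (toConv c - toConv (c ∘ₗ P)) := by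
      rw [sub_mul, mul_sub, sub_add_sub_cancel]
    rw [this]
    exact I.add_mem (hr _ _ (hmem (toConv a))) (hl _ _ (hmem (toConv c)))
  rw [LinearMap.convMul_apply, LinearMap.convMul_apply] at h1
  rw [← LinearMap.comp_apply (TensorProduct.map (dualPerp I).subtype _), ← TensorProduct.map_comp,
    ← LinearMap.comp_apply (TensorProduct.map a c), ← TensorProduct.map_comp]
  exact h1.symm

section Block
variable {d : ℕ} {φ : WithConv (H →ₗ[k] k) →ₐ[k] Matrix (Fin d) (Fin d) k}

theorem finrank_dualPerp_ker (hφ : Function.Surjective φ) :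
    Module.finrank k (dualPerp (LinearMap.ker φ.toLinearMap)) = d ^ 2 := by
  have h1 := finrank_dualPerp (LinearMap.ker φ.toLinearMap)
  have : FiniteDimensional k (WithConv (H →ₗ[k] k)) :=
    Module.Finite.equiv (WithConv.linearEquiv k (H →ₗ[k] k)).symm
  have h2 := LinearMap.finrank_range_add_finrank_ker φ.toLinearMap
  rw [LinearMap.range_eq_top.mpr hφ, finrank_top, Module.finrank_matrix,
    (WithConv.linearEquiv k (H →ₗ[k] k)).finrank_eq] at h2
  have h3 : Module.finrank k (H →ₗ[k] k) = Module.finrank k H := Subspace.dual_finrank_eq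
  simp only [Fintype.card_fin, Module.finrank_self, mul_one] at h2
  rw [sq]
  omega

theorem isSimpleSubcoalgebra_dualPerp_ker (hφ : Function.Surjective φ) (hd : d ≠ 0) :
    IsSimpleSubcoalgebra (dualPerp (LinearMap.ker φ.toLinearMap)) := by
  refine ⟨isSubcoalgebra_dualPerp ?_ ?_, ?_, ?_⟩
  · intro a i hi
    have : φ i = 0 := hi
    simp [this]
  · intro a i hi
    have : φ i = 0 := hi
    simp [this]
  · intro h
    have := finrank_dualPerp_ker hφ
    rw [h, finrank_bot] at this
    exact hd (pow_eq_zero_iff two_ne_zero |>.mp this.symm)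
  · intro B hB hle
    have hker : LinearMap.ker φ.toLinearMap ≤ dualAnnih B := by
      intro a ha h hh
      exact hle hh a ha
    rcases exists_mem_map_eq_one hφ (fun a i hi => hB.mul_mem a i hi)
      (fun a i hi => hB.mul_mem' a i hi) with h1 | ⟨a, ha, h1⟩
    · right
      rw [← dualPerp_dualAnnih B, le_antisymm h1 hker]
    · left
      have h2 : (1 : WithConv (H →ₗ[k] k)) - a ∈ LinearMap.ker φ.toLinearMap := by simp [h1]
      have h3 : (1 : WithConv (H →ₗ[k] k)) ∈ dualAnnih B := by
        have := (dualAnnih B).add_mem (hker h2) ha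
        simpa using this
      rw [eq_bot_iff]
      intro x hx
      have : x = 0 := by
        apply eq_of_forall_conv (k := k)
        intro c
        have := hB.mul_mem c 1 h3 x hx
        rw [mul_one] at this
        simp [this]
      simp [this]

/-- Otherwise every D in S is annihilated by some functional mapping to 1 under φ. A finite product
of these annihilates the whole sum, so it lies in the kernel of φ, yet still maps to 1. -/
theorem exists_le_of_dualPerp_ker_le_sSup (hφ : Function.Surjective φ) (hd : d ≠ 0)
    {S : Set (Submodule k H)} (hS : ∀ D ∈ S, IsSubcoalgebra D)
    (hle : dualPerp (LinearMap.ker φ.toLinearMap) ≤ sSup S) :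
    ∃ D ∈ S, dualPerp (LinearMap.ker φ.toLinearMap) ≤ D := by
  by_contra! hcon
  have h1 : ∀ D ∈ S, ∃ a ∈ dualAnnih D, φ a = 1 := by
    intro D hD
    refine (exists_mem_map_eq_one hφ (fun a i hi => (hS D hD).mul_mem a i hi)
      (fun a i hi => (hS D hD).mul_mem' a i hi)).resolve_left fun h => hcon D hD ?_
    rw [← dualPerp_dualAnnih D]
    exact dualPerp_anti h
  obtain ⟨t, ht, hsup⟩ := CompleteLattice.WellFoundedGT.isSupFiniteCompact (Submodule k H) S
  have h2 : ∀ t : Finset (Submodule k H), ↑t ⊆ S → ∃ a, φ a = 1 ∧ ∀ D ∈ t, a ∈ dualAnnih D := by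
    classical
    intro t
    induction t using Finset.induction_on with
    | empty => exact fun _ => ⟨1, map_one _, by simp⟩
    | insert D t _ ih =>
      intro hts
      rw [Finset.coe_insert, Set.insert_subset_iff] at hts
      obtain ⟨a, ha, hat⟩ := ih hts.2
      obtain ⟨c, hc, hc1⟩ := h1 D hts.1
      refine ⟨c * a, by rw [map_mul, ha, hc1, one_mul], fun D' hD' => ?_⟩
      rcases Finset.mem_insert.mp hD' with rfl | hD'
      · exact (hS _ hts.1).mul_mem' a c hc
      · exact (hS _ (hts.2 hD')).mul_mem c a (hat _ hD')
  obtain ⟨a, ha, hat⟩ := h2 t ht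
  have h3 : a ∈ LinearMap.ker φ.toLinearMap := by
    rw [← dualAnnih_dualPerp (LinearMap.ker φ.toLinearMap)]
    intro x hx
    have hx' := hle hx
    rw [hsup] at hx'
    have h4 : t.sup id ≤ LinearMap.ker a.ofConv :=
      Finset.sup_le fun D hD y hy => hat D hD y hy
    exact h4 hx'
  have h4 : φ a = 0 := h3
  rw [ha] at h4
  have := congrFun (congrFun h4 ⟨0, Nat.pos_of_ne_zero hd⟩) ⟨0, Nat.pos_of_ne_zero hd⟩
  simp at this

theorem exists_multiplicativeMatrix (φ : WithConv (H →ₗ[k] k) →ₐ[k] Matrix (Fin d) (Fin d) k) :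
    ∃ (u : Matrix (Fin d) (Fin d) H) (hu : IsMultiplicativeMatrix k u), hu.rep = φ := by
  choose u hu using fun i j => exists_eval_eq
    ((LinearMap.proj j ∘ₗ LinearMap.proj i : Matrix (Fin d) (Fin d) k →ₗ[k] k) ∘ₗ φ.toLinearMap)
  have hu' : ∀ i j a, φ a i j = a (u i j) := fun i j a => hu i j a
  have hm : IsMultiplicativeMatrix k (Matrix.of u) := by
    apply IsMultiplicativeMatrix.of_conv
    · intro a c i j
      simp only [Matrix.of_apply]
      rw [← hu', map_mul, Matrix.mul_apply]
      simp only [hu']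
    · intro i j
      rw [Matrix.of_apply, ← hu', map_one, Matrix.one_apply]
  refine ⟨Matrix.of u, hm, ?_⟩
  ext a i j
  rw [hm.rep_apply, hu', Matrix.of_apply]

end Block

/-- By simplicity the annihilator of J + C^⊥ is C or 0. In the latter case 1 = x + y with x in J
nilpotent, so y in C^⊥ is a unit and C = 0. -/
theorem IsSimpleSubcoalgebra.le_dualPerp {C : Submodule k H} (hC : IsSimpleSubcoalgebra C)
    {J : Submodule k (WithConv (H →ₗ[k] k))} (hl : ∀ a, ∀ j ∈ J, a * j ∈ J)
    (hr : ∀ a, ∀ j ∈ J, j * a ∈ J) {m : ℕ} (hm : J ^ m = ⊥) : C ≤ dualPerp J := by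
  obtain ⟨hsub, hne, hmin⟩ := hC
  have hB : IsSubcoalgebra (dualPerp (J ⊔ dualAnnih C)) := by
    apply isSubcoalgebra_dualPerp
    · intro a i hi
      obtain ⟨x, hx, y, hy, rfl⟩ := Submodule.mem_sup.mp hi
      rw [mul_add]
      exact Submodule.add_mem_sup (hl a x hx) (hsub.mul_mem a y hy)
    · intro a i hi
      obtain ⟨x, hx, y, hy, rfl⟩ := Submodule.mem_sup.mp hi
      rw [add_mul]
      exact Submodule.add_mem_sup (hr a x hx) (hsub.mul_mem' a y hy)
  have hle : dualPerp (J ⊔ dualAnnih C) ≤ C := by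
    conv_rhs => rw [← dualPerp_dualAnnih C]
    exact dualPerp_anti le_sup_right
  rcases hmin _ hB hle with h | h
  · exfalso
    have htop : (1 : WithConv (H →ₗ[k] k)) ∈ J ⊔ dualAnnih C := by
      rw [← dualAnnih_dualPerp (J ⊔ dualAnnih C), h]
      intro x hx
      rw [(Submodule.mem_bot k).mp hx, map_zero]
    obtain ⟨x, hx, y, hy, hxy⟩ := Submodule.mem_sup.mp htop
    have hnil : IsNilpotent x := ⟨m, by
      have := Submodule.pow_mem_pow J hx m
      rw [hm] at this
      simpa using this⟩
    obtain ⟨w, hw⟩ := hnil.isUnit_one_sub.exists_left_inv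
    have h1 : (1 : WithConv (H →ₗ[k] k)) ∈ dualAnnih C := by
      rw [← hw, ← hxy, add_sub_cancel_left]
      exact hsub.mul_mem w y hy
    apply hne
    rw [eq_bot_iff]
    intro z hz
    have : z = 0 := by
      apply eq_of_forall_conv (k := k)
      intro c
      have := hsub.mul_mem c 1 h1 z hz
      rw [mul_one] at this
      simp [this]
    simp [this]
  · rw [← h]
    exact dualPerp_anti le_sup_left

end Duality

/-! ### Unimodularity, ε-derivations and the trace count -/

section Main
variable {k H : Type*} [Field k] [Ring H] [HopfAlgebra k H]

variable (k H) in
/-- Evaluation at `1`, the counit of the convolution algebra. -/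
noncomputable def convAugmentation : WithConv (H →ₗ[k] k) →ₐ[k] k :=
  AlgHom.ofLinearMap
    { toFun := fun a => a 1
      map_add' := fun a c => rfl
      map_smul' := fun r a => rfl }
    (by
      change (1 : WithConv (H →ₗ[k] k)) 1 = 1
      simp)
    (fun a c => by
      change (a * c) 1 = a 1 * c 1
      simp [LinearMap.convMul_apply, Algebra.TensorProduct.one_def])

@[simp] theorem convAugmentation_apply (a : WithConv (H →ₗ[k] k)) :
    convAugmentation k H a = a 1 := rfl

variable [FiniteDimensional k H]

/-- By uniqueness l * a = c(a) l, and c is a character of A, hence equal to ε. -/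
theorem IsLeftIntegral.isRightIntegral
    (huniq : ∀ α : WithConv (H →ₗ[k] k) →ₐ[k] k, α = convAugmentation k H)
    {l : WithConv (H →ₗ[k] k)} (hl : IsLeftIntegral l) : IsRightIntegral l := by
  by_cases h0 : l = 0
  · intro a; simp [h0]
  have hex : ∀ a, ∃ c : k, l * a = c • l := fun a =>
    hl.eq_smul h0 (l' := l * a) fun x => by rw [← mul_assoc, hl x, smul_mul_assoc]
  choose c hc using hex
  have hinj : ∀ {r s : k}, r • l = s • l → r = s := fun h => smul_left_injective k h0 h
  let α : WithConv (H →ₗ[k] k) →ₐ[k] k := AlgHom.ofLinearMap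
    { toFun := c
      map_add' := fun a b => hinj (by rw [← hc, mul_add, hc, hc, add_smul])
      map_smul' := fun r a => hinj (by
        rw [← hc, mul_smul_comm, hc, RingHom.id_apply, smul_smul, smul_eq_mul]) }
    (hinj (by
      change c 1 • l = _
      rw [← hc, mul_one, one_smul]))
    (fun a b => hinj (by
      change c (a * b) • l = (c a * c b) • l
      rw [← hc, ← mul_assoc, hc, smul_mul_assoc, hc, smul_smul]))
  intro a
  rw [hc]
  congr 1
  exact congr($(huniq α) a)

theorem isLeftIntegral_iff_isRightIntegral
    (huniq : ∀ α : WithConv (H →ₗ[k] k) →ₐ[k] k, α = convAugmentation k H)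
    (l : WithConv (H →ₗ[k] k)) : IsLeftIntegral l ↔ IsRightIntegral l := by
  refine ⟨fun h => h.isRightIntegral huniq, fun h => ?_⟩
  obtain ⟨l', hl', h0⟩ := exists_isLeftIntegral_ne_zero k H
  obtain ⟨c, rfl⟩ := (hl'.isRightIntegral huniq).eq_smul hl' h0 h0 h
  intro a
  rw [mul_smul_comm, hl' a, smul_comm]

/-- A functional on U killing U² + XY yields an ε-derivation of A. Such a derivation is evaluation
at a primitive element of H, which is zero. -/
theorem augmentation_corner_le [CharZero k] {J : Submodule k (WithConv (H →ₗ[k] k))}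
    {e : WithConv (H →ₗ[k] k)} (h : IsUnimodularAugmentation (convAugmentation k H) J e)
    (hJ : ∀ j ∈ J, convAugmentation k H j = 0) :
    peirceCorner J e e ≤ peirceCorner J e e * peirceCorner J e e ⊔
      peirceCorner J e (1 - e) * peirceCorner J (1 - e) e := by
  intro u hu
  by_contra hnot
  obtain ⟨f, hf, hle⟩ := Submodule.exists_le_ker_of_notMem hnot
  set ε := convAugmentation k H
  let δ : WithConv (H →ₗ[k] k) →ₗ[k] k := f ∘ₗ
    (LinearMap.mulLeft k e ∘ₗ LinearMap.mulRight k e - ε.toLinearMap.smulRight e)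
  have hδ : ∀ a, δ a = f (e * (a * e) - ε a • e) := fun a => rfl
  obtain ⟨x, hx⟩ := exists_eval_eq δ
  have hee := h.idem.eq
  have hred : ∀ a, e * (a * e) - ε a • e ∈ peirceCorner J e e := by
    intro a
    have h1 : e * (a * e) - ε a • e = e * (a * e - ε a • e) := by
      rw [mul_sub, mul_smul_comm, hee]
    refine ⟨?_, ?_, ?_⟩
    · rw [h1]; exact h.left_mem _ _ (h.mul_sub_mem a)
    · rw [h1, ← mul_assoc, hee]
    · rw [sub_mul, smul_mul_assoc, mul_assoc, mul_assoc, hee]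
  have hleft : ∀ a, e * a * (1 - e) ∈ peirceCorner J e (1 - e) := by
    intro a
    refine ⟨?_, ?_, ?_⟩
    · have : e * a * (1 - e) = (e * a - ε a • e) * (1 - e) := by
        rw [sub_mul (e * a), smul_mul_assoc, mul_sub e, hee]; simp
      rw [this]
      exact h.right_mem _ _ (h.sub_mul_mem a)
    · rw [← mul_assoc, ← mul_assoc, hee]
    · rw [mul_assoc, h.idem.one_sub.eq]
  have hright : ∀ a, (1 - e) * (a * e) ∈ peirceCorner J (1 - e) e := by
    intro a
    refine ⟨?_, ?_, ?_⟩
    · have : (1 - e) * (a * e) = (1 - e) * (a * e - ε a • e) := by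
        rw [mul_sub (1 - e), mul_smul_comm, sub_mul 1 e e, hee]; simp
      rw [this]
      exact h.left_mem _ _ (h.mul_sub_mem a)
    · rw [← mul_assoc, h.idem.one_sub.eq]
    · rw [mul_assoc, mul_assoc, hee]
  have hmul : ∀ a c, δ (a * c) = ε a * δ c + δ a * ε c := by
    intro a c
    set p := e * (a * e) - ε a • e with hp
    set q := e * (c * e) - ε c • e with hq
    have hep : e * p = p := (hred a).2.1
    have hpe : p * e = p := (hred a).2.2
    have heq : e * q = q := (hred c).2.1
    have hdec : e * (a * c * e) - ε (a * c) • e =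
        ε a • q + ε c • p + (p * q + e * a * (1 - e) * ((1 - e) * (c * e))) := by
      have h1 : e * (a * c * e) =
          (e * (a * e)) * (e * (c * e)) + e * a * (1 - e) * ((1 - e) * (c * e)) := by
        have h2 : (e * (a * e)) * (e * (c * e)) = e * a * e * (c * e) := by
          rw [mul_assoc e (a * e), mul_assoc a e, ← mul_assoc e e, hee]
          simp only [mul_assoc]
        have h3 : e * a * (1 - e) * ((1 - e) * (c * e)) = e * a * (1 - e) * (c * e) := by
          rw [mul_assoc (e * a), ← mul_assoc (1 - e) (1 - e), h.idem.one_sub.eq,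
            mul_assoc (e * a) (1 - e)]
        rw [h2, h3, ← add_mul, ← mul_add, add_sub_cancel, mul_one]
        simp only [mul_assoc]
      have ha : e * (a * e) = p + ε a • e := by rw [hp]; abel
      have hc : e * (c * e) = q + ε c • e := by rw [hq]; abel
      rw [h1, ha, hc, add_mul, mul_add, mul_add, mul_smul_comm, smul_mul_assoc, smul_mul_assoc,
        mul_smul_comm, hpe, heq, hee, map_mul, mul_smul]
      abel
    have hker : f (p * q + e * a * (1 - e) * ((1 - e) * (c * e))) = 0 :=
      hle (Submodule.add_mem_sup (Submodule.mul_mem_mul (hred a) (hred c))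
        (Submodule.mul_mem_mul (hleft a) (hright c)))
    rw [hδ, hdec, map_add, hker, map_add, map_smul, map_smul, hδ, hδ, smul_eq_mul, smul_eq_mul]
    ring
  have hprim : comul (R := k) x = 1 ⊗ₜ[k] x + x ⊗ₜ[k] 1 := by
    apply tensorProduct_ext_dual
    intro a c
    have h1 := hmul (toConv a) (toConv c)
    rw [hx, hx, hx, LinearMap.convMul_apply] at h1
    simpa [ε] using h1
  have hx0 := eq_zero_of_primitive hprim
  apply hf
  have h1 := hx u
  rw [hx0, map_zero, hδ, hJ u hu.1, zero_smul, sub_zero, hu.2.2, hu.2.1] at h1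
  exact h1

omit [FiniteDimensional k H] in
-- Take traces of 1 = e + ∑ E a a on V ⊗ V*: e contributes 1 and the N conjugate idempotents
-- contribute equally, so d² = 1 + Nm, while N ∣ d.
theorem IsMultiplicativeMatrix.card_eq_one_of_integral [CharZero k] {d N : ℕ} (hN : N ∣ d)
    (hd : d ≠ 0) {u : Matrix (Fin d) (Fin d) H} (hu : IsMultiplicativeMatrix k u)
    (hsurj : Function.Surjective hu.rep) {e : WithConv (H →ₗ[k] k)} (he : IsLeftIntegral e)
    (he1 : e 1 = 1) {E : Fin N → Fin N → WithConv (H →ₗ[k] k)} (hE : IsMatrixUnits E)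
    (hsum : ∑ a, E a a = 1 - e) : N = 1 := by
  have : Nonempty (Fin d) := ⟨⟨0, Nat.pos_of_ne_zero hd⟩⟩
  have htr := hu.trace_adjoint_integral hsurj he he1
  set ρ := hu.adjoint.rep
  have hN0 : N ≠ 0 := by
    rintro rfl
    exact hd (Nat.eq_zero_of_zero_dvd hN)
  let o : Fin N := ⟨0, Nat.pos_of_ne_zero hN0⟩
  obtain ⟨m, hm⟩ : ∃ m : ℕ, (ρ (E o o)).trace = m := by
    refine ⟨Module.finrank k (LinearMap.range (Matrix.toLin' (ρ (E o o)))), ?_⟩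
    rw [← Matrix.trace_toLin'_eq]
    refine (LinearMap.IsIdempotentElem.isProj_range _ ?_).trace
    rw [IsIdempotentElem, Module.End.mul_eq_comp, ← Matrix.toLin'_mul, ← map_mul, hE.mul_same]
  have htrE : ∀ a, (ρ (E a a)).trace = m := by
    intro a
    rw [← hE.mul_same a o a, map_mul, Matrix.trace_mul_comm, ← map_mul, hE.mul_same, hm]
  have h1 : (d ^ 2 : k) = 1 + N * m := by
    have h2 : (1 : WithConv (H →ₗ[k] k)) = e + ∑ a, E a a := by rw [hsum]; abel
    have h3 := congrArg (fun a => (ρ a).trace) h2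
    simp only [map_one, Matrix.trace_one, map_add, map_sum, Matrix.trace_add, Matrix.trace_sum,
      htr, htrE, Fintype.card_prod, Fintype.card_fin, Finset.sum_const, Finset.card_univ,
      nsmul_eq_mul, Nat.cast_mul] at h3
    rw [sq, h3]
  have h2 : d ^ 2 = 1 + N * m := by exact_mod_cast h1
  have h3 : N ∣ 1 := by
    rw [Nat.dvd_add_left (Dvd.intro m rfl) |>.symm, ← h2]
    exact hN.trans (Dvd.intro_left _ (sq d).symm)
  exact Nat.dvd_one.mp h3

end Main

/-! ### Block structure dictated by the coradical -/

section Main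
variable {k H : Type*} [Field k] [Ring H] [HopfAlgebra k H] [FiniteDimensional k H]

/-- A presentation of the convolution algebra modulo a nilpotent ideal as a product of matrix
algebras, in which one block is the trivial representation and all others have size divisible
by `N`. -/
structure IsBlockPresentation {n : ℕ} {d : Fin n → ℕ} (N : ℕ)
    (φ : WithConv (H →ₗ[k] k) →ₐ[k] Π i, Matrix (Fin (d i)) (Fin (d i)) k) (o : Fin n) : Prop where
  surj : Function.Surjective φ
  nilpotent : ∃ m : ℕ, (LinearMap.ker φ.toLinearMap) ^ m = ⊥
  size_ne_zero : ∀ i, d i ≠ 0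
  size_trivial : d o = 1
  apply_trivial : ∀ a, φ a o = a 1 • 1
  dvd : ∀ i, i ≠ o → N ∣ d i

omit [FiniteDimensional k H] in
theorem surjective_block {n : ℕ} {d : Fin n → ℕ}
    {φ : WithConv (H →ₗ[k] k) →ₐ[k] Π i, Matrix (Fin (d i)) (Fin (d i)) k}
    (hφ : Function.Surjective φ) (i : Fin n) :
    Function.Surjective ((Pi.evalAlgHom k (fun i => Matrix (Fin (d i)) (Fin (d i)) k) i).comp φ) :=
  (Function.surjective_eval i).comp hφ

/-- Each block is dual to a simple subcoalgebra of dimension d². It lies in k·1 or equals a member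
of F, and in the second case N² ∣ d². -/
theorem exists_isBlockPresentation [IsAlgClosed k] {N : ℕ} {F : Set (Submodule k H)}
    (h_simple : ∀ C ∈ F, IsSimpleSubcoalgebra C)
    (h_dvd : ∀ C ∈ F, N ^ 2 ∣ Module.finrank k C)
    (h_sup : coradical k H = Submodule.span k {(1 : H)} ⊔ sSup F) :
    ∃ (n : ℕ) (d : Fin n → ℕ)
      (φ : WithConv (H →ₗ[k] k) →ₐ[k] Π i, Matrix (Fin (d i)) (Fin (d i)) k) (o : Fin n),
      IsBlockPresentation N φ o := by
  obtain ⟨n, d, φ, hd, hφ, m, hm⟩ :=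
    exists_surjective_algHom_pi_matrix (k := k) (A := WithConv (H →ₗ[k] k))
  let ψ i := (Pi.evalAlgHom k (fun i => Matrix (Fin (d i)) (Fin (d i)) k) i).comp φ
  have hψ : ∀ i, Function.Surjective (ψ i) := surjective_block hφ
  have hone : IsSubcoalgebra (Submodule.span k {(1 : H)}) := by
    intro x hx
    obtain ⟨c, rfl⟩ := Submodule.mem_span_singleton.mp hx
    refine ⟨c • ((⟨1, Submodule.mem_span_singleton_self 1⟩ : Submodule.span k {(1 : H)}) ⊗ₜ[k]
      ⟨1, Submodule.mem_span_singleton_self 1⟩), ?_⟩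
    simp [Algebra.TensorProduct.one_def]
  have hdich : ∀ i, N ∣ d i ∨ ∀ a, φ a i = 0 → a 1 = 0 := by
    intro i
    have hs := isSimpleSubcoalgebra_dualPerp_ker (hψ i) (hd i)
    have hle : dualPerp (LinearMap.ker (ψ i).toLinearMap) ≤
        sSup (insert (Submodule.span k {(1 : H)}) F) := by
      rw [sSup_insert, ← h_sup]
      exact le_sSup hs
    obtain ⟨D, hD, hDle⟩ := exists_le_of_dualPerp_ker_le_sSup (hψ i) (hd i) (by
      rintro D (rfl | hD)
      · exact hone
      · exact (h_simple D hD).1) hle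
    rcases hD with rfl | hD
    · right
      intro a ha
      have h1 : dualPerp (LinearMap.ker (ψ i).toLinearMap) = Submodule.span k {(1 : H)} := by
        apply Submodule.eq_of_le_of_finrank_le hDle
        refine (finrank_span_le_card _).trans ?_
        rw [Set.toFinset_singleton, Finset.card_singleton]
        rw [Nat.one_le_iff_ne_zero]
        intro h0
        exact hs.2.1 (Submodule.finrank_eq_zero.mp h0)
      have h2 : (1 : H) ∈ dualPerp (LinearMap.ker (ψ i).toLinearMap) := by
        rw [h1]; exact Submodule.mem_span_singleton_self 1
      exact h2 a ha
    · left
      have h1 := ((h_simple D hD).2.2 _ hs.1 hDle).resolve_left hs.2.1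
      have h2 := h_dvd D hD
      rw [← h1, finrank_dualPerp_ker (hψ i)] at h2
      exact (Nat.pow_dvd_pow_iff two_ne_zero).mp h2
  obtain ⟨o, ho⟩ := exists_character_factor hφ hm (convAugmentation k H)
  obtain ⟨hdo, hψo⟩ := character_eq_of_factor (hψ o) ho
  refine ⟨n, d, φ, o, hφ, ⟨m, hm⟩, hd, hdo, hψo, fun i hi => (hdich i).resolve_right fun h => ?_⟩
  -- Only one block is trivial: a lift of the unit of block o vanishes in block i, but its value at
  -- 1 is nonzero.
  obtain ⟨a, ha⟩ := hφ (Pi.single o 1)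
  have h1 : a 1 = 0 := h a (by rw [ha, Pi.single_eq_of_ne hi])
  have h2 : φ a o = a 1 • 1 := hψo a
  rw [ha, Pi.single_eq_same, h1, zero_smul] at h2
  have : Nonempty (Fin (d o)) := ⟨⟨0, Nat.pos_of_ne_zero (hd o)⟩⟩
  exact one_ne_zero h2

namespace IsBlockPresentation
variable {n N : ℕ} {d : Fin n → ℕ}
  {φ : WithConv (H →ₗ[k] k) →ₐ[k] Π i, Matrix (Fin (d i)) (Fin (d i)) k} {o : Fin n}

/-- A character factors through a block of size 1, and N > 1 leaves only the trivial one. -/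
theorem eq_convAugmentation (h : IsBlockPresentation N φ o) (hN : 1 < N)
    (α : WithConv (H →ₗ[k] k) →ₐ[k] k) : α = convAugmentation k H := by
  obtain ⟨m, hm⟩ := h.nilpotent
  obtain ⟨i, hi⟩ := exists_character_factor h.surj hm α
  obtain ⟨hd, hα⟩ := character_eq_of_factor (surjective_block h.surj i) hi
  have hio : i = o := by
    by_contra hne
    have := h.dvd i hne
    rw [hd, Nat.dvd_one] at this
    omega
  subst hio
  have : Nonempty (Fin (d i)) := ⟨⟨0, Nat.pos_of_ne_zero (h.size_ne_zero i)⟩⟩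
  ext a
  have h1 : φ a i = α a • 1 := hα a
  rw [h.apply_trivial] at h1
  exact (smul_left_injective k (one_ne_zero (α := Matrix (Fin (d i)) (Fin (d i)) k)) h1).symm

omit [FiniteDimensional k H] in
theorem apply_one_of_map_eq_zero (h : IsBlockPresentation N φ o) {a : WithConv (H →ₗ[k] k)}
    (ha : φ a = 0) : a 1 = 0 := by
  have : Nonempty (Fin (d o)) := ⟨⟨0, Nat.pos_of_ne_zero (h.size_ne_zero o)⟩⟩
  have h1 := h.apply_trivial a
  rw [ha] at h1
  exact (smul_eq_zero.mp h1.symm).resolve_right one_ne_zero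

omit [FiniteDimensional k H] in
theorem exists_idempotents (h : IsBlockPresentation N φ o) :
    ∃ (e : WithConv (H →ₗ[k] k)) (E : Fin N → Fin N → WithConv (H →ₗ[k] k)),
      IsMatrixUnits E ∧ ∑ a, E a a = 1 - e ∧ φ e = Pi.single o 1 := by
  choose G hG hG1 using fun i : {i // i ≠ o} => exists_matrixUnits_of_dvd (k := k) (h.dvd i i.2)
  let G' : Fin N → Fin N → Π i, Matrix (Fin (d i)) (Fin (d i)) k := fun a b i =>
    if hi : i ≠ o then G ⟨i, hi⟩ a b else 0
  have hG' : IsMatrixUnits G' := by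
    intro a b c f
    ext1 i
    by_cases hi : i = o
    · split_ifs <;> simp [G', hi]
    · have := hG ⟨i, hi⟩ a b c f
      split_ifs at this ⊢ <;> simpa [G', hi] using this
  obtain ⟨m, hm⟩ := h.nilpotent
  obtain ⟨E, hE, hEG⟩ := exists_lift_matrixUnits φ.toRingHom h.surj (fun x hx => ⟨m, by
    have := Submodule.pow_mem_pow (LinearMap.ker φ.toLinearMap) hx m
    rw [hm] at this
    simpa using this⟩) hG'
  refine ⟨1 - ∑ a, E a a, E, hE, by simp, ?_⟩
  have hEG' : ∀ a b, φ (E a b) = G' a b := hEG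
  rw [map_sub, map_one, map_sum]
  simp only [hEG']
  ext1 i
  rw [Pi.sub_apply, Finset.sum_apply]
  by_cases hi : i = o
  · subst hi
    simp [G']
  · simp [G', hi, hG1 ⟨i, hi⟩]

theorem isUnimodularAugmentation (h : IsBlockPresentation N φ o) (hN : 1 < N)
    {e : WithConv (H →ₗ[k] k)} (he : IsIdempotentElem e) (hφe : φ e = Pi.single o 1) :
    IsUnimodularAugmentation (convAugmentation k H) (LinearMap.ker φ.toLinearMap) e where
  idem := he
  left_mem a j hj := by
    have : φ j = 0 := hj
    simp [this]
  right_mem a j hj := by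
    have : φ j = 0 := hj
    simp [this]
  nilpotent := h.nilpotent
  mul_sub_mem a := by
    have : φ (a * e - a 1 • e) = 0 := by
      rw [map_sub, map_mul, map_smul, hφe]
      ext1 i
      by_cases hi : i = o
      · subst hi; simp [h.apply_trivial]
      · simp [hi]
    exact this
  sub_mul_mem a := by
    have : φ (e * a - a 1 • e) = 0 := by
      rw [map_sub, map_mul, map_smul, hφe]
      ext1 i
      by_cases hi : i = o
      · subst hi; simp [h.apply_trivial]
      · simp [hi]
    exact this
  unique x y hx hy h0 := IsLeftIntegral.eq_smul (l := x) hx h0 hy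
  left_iff_right := isLeftIntegral_iff_isRightIntegral (h.eq_convAugmentation hN)

theorem corner_ne_bot [CharZero k] (h : IsBlockPresentation N φ o) (hN : 1 < N)
    (hH : 1 < Module.finrank k H) {e : WithConv (H →ₗ[k] k)} (he : IsIdempotentElem e)
    (hφe : φ e = Pi.single o 1) {E : Fin N → Fin N → WithConv (H →ₗ[k] k)} (hE : IsMatrixUnits E)
    (hsum : ∑ a, E a a = 1 - e) : peirceCorner (LinearMap.ker φ.toLinearMap) e e ≠ ⊥ := by
  intro hbot
  have : Nonempty (Fin (d o)) := ⟨⟨0, Nat.pos_of_ne_zero (h.size_ne_zero o)⟩⟩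
  have he1 : e 1 = 1 := by
    have h1 := h.apply_trivial e
    rw [hφe, Pi.single_eq_same] at h1
    have h2 : (e 1 - 1) • (1 : Matrix (Fin (d o)) (Fin (d o)) k) = 0 := by
      rw [sub_smul, ← h1, one_smul, sub_self]
    exact sub_eq_zero.mp ((smul_eq_zero.mp h2).resolve_right one_ne_zero)
  obtain ⟨l, hl, h0⟩ := exists_isLeftIntegral_ne_zero k H
  have hr := hl.isRightIntegral (h.eq_convAugmentation hN)
  have hel : e * l = l := by rw [hl e, he1, one_smul]
  have hle : l * e = l := by rw [hr e, he1, one_smul]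
  -- As the corner is zero, l is a multiple of e, so e is itself a normalised integral.
  have hlc : l - l 1 • e ∈ peirceCorner (LinearMap.ker φ.toLinearMap) e e := by
    refine ⟨?_, ?_, ?_⟩
    · have := (h.isUnimodularAugmentation hN he hφe).mul_sub_mem l
      rwa [hle] at this
    · rw [mul_sub, hel, mul_smul_comm, he.eq]
    · rw [sub_mul, hle, smul_mul_assoc, he.eq]
  rw [hbot, Submodule.mem_bot, sub_eq_zero] at hlc
  have hl1 : l 1 ≠ 0 := by
    intro h1
    rw [h1, zero_smul] at hlc
    exact h0 hlc
  have heint : IsLeftIntegral e := by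
    have : e = (l 1)⁻¹ • l := by
      conv_rhs => rw [hlc]
      rw [smul_smul, ofConv_smul, LinearMap.smul_apply, he1, smul_eq_mul, mul_one,
        inv_mul_cancel₀ hl1, one_smul]
    intro a
    rw [this, mul_smul_comm, hl a, smul_comm]
  by_cases hi : ∃ i, i ≠ o
  · obtain ⟨i, hi⟩ := hi
    obtain ⟨u, hu, hrep⟩ := exists_multiplicativeMatrix
      ((Pi.evalAlgHom k (fun i => Matrix (Fin (d i)) (Fin (d i)) k) i).comp φ)
    have := hu.card_eq_one_of_integral (h.dvd i hi) (h.size_ne_zero i)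
      (by rw [hrep]; exact surjective_block h.surj i) heint he1 hE hsum
    omega
  -- Without other blocks 1 - e is idempotent and nilpotent, so e = 1 is an integral and dim H ≤ 1.
  · push Not at hi
    have hker : 1 - e ∈ LinearMap.ker φ.toLinearMap := by
      have : φ (1 - e) = 0 := by
        rw [map_sub, map_one, hφe]
        ext1 i
        obtain rfl := hi i
        simp
      exact this
    obtain ⟨m, hm⟩ := h.nilpotent
    have h1 : (1 - e) ^ (m + 1) = 0 := by
      have := Submodule.pow_mem_pow _ hker m
      rw [hm, Submodule.mem_bot] at this
      rw [pow_succ, this, zero_mul]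
    rw [he.one_sub.pow_succ_eq, sub_eq_zero] at h1
    have h2 : Module.finrank k (WithConv (H →ₗ[k] k)) ≤ 1 := by
      refine finrank_le_one (1 : WithConv (H →ₗ[k] k)) fun a => ⟨a 1, ?_⟩
      have := heint a
      rw [← h1, mul_one] at this
      exact this.symm
    rw [finrank_withConv_dual] at h2
    omega

theorem finrank_modEq (h : IsBlockPresentation N φ o) :
    Module.finrank k H ≡ Module.finrank k (LinearMap.ker φ.toLinearMap) + 1 [MOD N] := by
  have h1 := LinearMap.finrank_range_add_finrank_ker φ.toLinearMap
  rw [LinearMap.range_eq_top.mpr h.surj, finrank_top, Module.finrank_pi_fintype,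
    finrank_withConv_dual] at h1
  rw [← h1, ← Finset.add_sum_erase _ _ (Finset.mem_univ o), Module.finrank_matrix]
  simp only [h.size_trivial, Fintype.card_fin, Module.finrank_self, mul_one]
  have h2 : N ∣ ∑ i ∈ Finset.univ.erase o,
      Module.finrank k (Matrix (Fin (d i)) (Fin (d i)) k) := by
    refine Finset.dvd_sum fun i hi => ?_
    rw [Module.finrank_matrix]
    simp only [Fintype.card_fin, Module.finrank_self, mul_one]
    exact (h.dvd i (Finset.ne_of_mem_erase hi)).mul_right _
  have h3 := h2.modEq_zero_nat.add_left
    (Module.finrank k (LinearMap.ker φ.toLinearMap) + 1)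
  rw [add_zero] at h3
  rwa [add_comm (1 + _), ← add_assoc]

theorem finrank_coradical_le (h : IsBlockPresentation N φ o) :
    Module.finrank k (coradical k H) + Module.finrank k (LinearMap.ker φ.toLinearMap) ≤
      Module.finrank k H := by
  obtain ⟨m, hm⟩ := h.nilpotent
  have hle : coradical k H ≤ dualPerp (LinearMap.ker φ.toLinearMap) := by
    refine sSup_le fun C hC => hC.le_dualPerp ?_ ?_ hm
    · intro a j hj
      have : φ j = 0 := hj
      simp [this]
    · intro a j hj
      have : φ j = 0 := hj
      simp [this]
  have h1 := Submodule.finrank_mono hle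
  have h2 := finrank_dualPerp (LinearMap.ker φ.toLinearMap)
  omega

end IsBlockPresentation

end Main

/-- The hypotheses `hE`, `h_simple`, `h_indep` say that `E` is the (internal) direct sum of the
simple subcoalgebras in `F`; `h_sup` and `h_disj` say that `H₀ = k·1 ⊕ E`. -/
theorem mainTheorem5 {k H : Type*} [Field k] [IsAlgClosed k] [CharZero k]
    [Ring H] [HopfAlgebra k H] [FiniteDimensional k H]
    (h_nontriv : 1 < Module.finrank k H)
    (N : ℕ) (hN : 1 < N)
    (E : Submodule k H) (F : Set (Submodule k H))
    (h_simple : ∀ C ∈ F, IsSimpleSubcoalgebra C)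
    (h_indep : sSupIndep F)
    (hE : E = sSup F)
    (h_dvd : ∀ C ∈ F, N ^ 2 ∣ Module.finrank k C)
    (h_disj : Disjoint (Submodule.span k {(1 : H)}) E)
    (h_sup : coradical k H = Submodule.span k {(1 : H)} ⊔ E)
    (d e : ℕ) (hd : d ≤ N - 1) (h_dim : Module.finrank k H ≡ d [MOD N])
    (he_pos : 1 ≤ e) (he_le : e ≤ N) (he : (e : ℤ) ≡ (d : ℤ) - 1 [ZMOD (N : ℤ)])
    (he_ne : e ≠ 1) :
    Module.finrank k (coradical k H) + 4 * N + 2 * N ^ 2 + e ≤ Module.finrank k H := by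
  subst hE
  obtain ⟨n, s, φ, o, h⟩ := exists_isBlockPresentation h_simple h_dvd h_sup
  obtain ⟨p, G, hG, hsum, hφp⟩ := h.exists_idempotents
  have hp : IsIdempotentElem p := by
    have h1 : IsIdempotentElem (∑ a, G a a) := by
      rw [IsIdempotentElem, Finset.sum_mul_sum]
      refine Finset.sum_congr rfl fun a _ => ?_
      rw [Finset.sum_eq_single a]
      · exact hG.mul_same a a a
      · intro b _ hb; rw [hG]; simp [hb.symm]
      · simp
    rw [hsum] at h1
    simpa using h1.one_sub
  have haug := h.isUnimodularAugmentation hN hp hφp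
  have hne := h.corner_ne_bot hN h_nontriv hp hφp hG hsum
  have hmod := haug.finrank_modEq hG hsum
  have hExt := augmentation_corner_le haug fun j hj => h.apply_one_of_map_eq_zero hj
  have hge := haug.finrank_ge hG hsum hExt
  have hcor := h.finrank_coradical_le
  have hH := h.finrank_modEq
  rw [Fintype.card_fin] at hmod hge
  have hpos : Module.finrank k (peirceCorner (LinearMap.ker φ.toLinearMap) p p) ≠ 0 :=
    fun h0 => hne (Submodule.finrank_eq_zero.mp h0)
  set t := Module.finrank k (peirceCorner (LinearMap.ker φ.toLinearMap) p p)
  have hte : (t : ℤ) ≡ e [ZMOD N] := by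
    have h1 : t + 1 ≡ d [MOD N] := ((hmod.add_right 1).symm.trans hH.symm).trans h_dim
    have h2 := (Int.natCast_modEq_iff.mpr h1).sub_right 1
    push_cast at h2
    rw [add_sub_cancel_right] at h2
    exact h2.trans he.symm
  -- Since t ≥ 1 and e is the representative of its class in 1, …, N, t < e would require e - t ≥ N.
  have het : e ≤ t := by
    by_contra hlt
    obtain ⟨c, hc⟩ := hte.dvd
    have hc0 : 0 < (N : ℤ) * c := by omega
    have hc1 : 0 < c := by
      by_contra hc2
      have := mul_nonpos_of_nonneg_of_nonpos (Int.natCast_nonneg N) (not_lt.mp hc2)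
      omega
    have : (N : ℤ) * 1 ≤ N * c := mul_le_mul_of_nonneg_left (by omega) (by omega)
    omega
  -- The bound 2 ≤ t comes from e ≥ 1, e ≠ 1 and e ≤ t.
  have := hge (by omega)
  omega
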